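/- Let $\mathbb{H}$ be the upper half-plane, $q=e^{2\pi i\tau}$, $D=\frac{1}{2\pi i}\frac{d}{d\tau}$, $\Gamma=SL_2(\mathbb{Z})$, and let $\Gamma_\infty\le\Gamma$ be the subgroup generated by $\pm\begin{pmatrix}1&1\\0&1\end{pmatrix}$. For a weight $w$ and a $q$-series $\phi(\tau)=\sum_{n\ge 0}a_nq^n$, the Poincaré average is $\mathbb{P}_w(\phi;\tau)=\sum_{M\in\Gamma_\infty\backslash\Gamma}(\phi|_wM)(\tau)$, where $(\phi|_wM)(\tau)=(c\tau+d)^{-w}\phi\left(\frac{a\tau+b}{c\tau+d}\right)$ for $M=\begin{pmatrix}a&b\\c&d\end{pmatrix}$. Put $P_{w,n}=\mathbb{P}_w(q^n)$; in particular $P_{w,0}$ is the normalized Eisenstein series $E_w$. The $m$-th Rankin–Cohen bracket of functions $f$ of weight $k$ and $g$ of weight $l$ is $$[f,g]_m=\sum_{j=0}^m(-1)^j\binom{k+m-1}{m-j}\binom{l+m-1}{j}\,D^jf\,D^{m-j}g.$$ Theorem. Let $f$ be a modular form of weight $k$ for $\Gamma$, let $l\ge 4$ be an even integer, and let $m,N\ge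 0$ be integers; assume $l\ge k+2$ if $f$ is not a cusp form. Set $$\phi(\tau)=q^N\sum_{r=0}^m(-1)^r\binom{k+m-1}{m-r}\binom{l+m-1}{r}N^{m-r}D^rf(\tau)=\sum_{n\ge 0}a_nq^n$$ (with $N^0=1$ also for $N=0$). Then $$[f,P_{l,N}]_m=\mathbb{P}_{k+l+2m}(\phi).$$ Here the average may be read in either of two ways. The series over $\Gamma_\infty\backslash\Gamma$ defining $\mathbb{P}_{k+l+2m}(\phi)$ converges absolutely and locally uniformly on $\mathbb{H}$, with sum $[f,P_{l,N}]_m$; and, at each point of $\mathbb{H}$, the series $\sum_{n\ge 0}a_nP_{k+l+2m,n}$ converges, with the same sum. -/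

import Mathlib

open UpperHalfPlane
open scoped MatrixGroups ModularForm Manifold

noncomputable section

namespace RankinCohenPoincare

/-- The subgroup `Γ_∞` of `Γ = SL₂(ℤ)` generated by `±T`, where `T = (1 1; 0 1)`. -/
def GammaInfty : Subgroup SL(2, ℤ) := Subgroup.closure {ModularGroup.T, -ModularGroup.T}

/-- The set `Γ_∞ \ Γ` of cosets `Γ_∞ M`, `M ∈ Γ`. -/
abbrev Cosets : Type := Quotient (QuotientGroup.rightRel GammaInfty)

/-- The summand `φ ∣_w M` of the Poincaré series, where `M` represents the given coset. For
`w` even and `φ` of period one it does not depend on the representative, see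
`poincareTerm_mk`. -/
def poincareTerm (w : ℤ) (φ : ℍ → ℂ) (c : Cosets) : ℍ → ℂ := φ ∣[w] c.out

/-- The Poincaré average `ℙ_w(φ; τ) = ∑_{M ∈ Γ_∞ \ Γ} (φ ∣_w M)(τ)`. -/
def poincareAverage (w : ℤ) (φ : ℍ → ℂ) : ℍ → ℂ := fun τ ↦ ∑' c : Cosets, poincareTerm w φ c τ

/-- The function `q ^ N`, where `q = exp (2 π i τ)`. -/
def qPow (N : ℕ) : ℍ → ℂ := fun τ ↦ Complex.exp (2 * Real.pi * Complex.I * τ) ^ N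

/-- The Poincaré series of exponential type `P_{w,N} = ℙ_w(q ^ N)`; in particular
`P_{w,0} = ℙ_w(1)` is the normalized Eisenstein series `E_w`. -/
def poincareSeries (w : ℤ) (N : ℕ) : ℍ → ℂ := poincareAverage w (qPow N)

/-- The iterated derivative `D ^ r`, where `D = (2 π i)⁻¹ d/dτ`. -/
def iterD (r : ℕ) (f : ℍ → ℂ) : ℍ → ℂ := Derivative.normalizedDerivOfComplex^[r] f

/-- The `m`-th Rankin–Cohen bracket `[f, g]_m` of functions of weights `k` and `l`. -/
def rankinCohen (k l : ℤ) (m : ℕ) (f g : ℍ → ℂ) : ℍ → ℂ := fun τ ↦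
  ∑ j ∈ Finset.range (m + 1), (-1) ^ j * ((Ring.choose (k + m - 1) (m - j) : ℤ) : ℂ) *
    ((Ring.choose (l + m - 1) j : ℤ) : ℂ) * iterD j f τ * iterD (m - j) g τ

/-- The seed function
`φ = q^N ∑_{r=0}^m (-1)^r C(k+m-1, m-r) C(l+m-1, r) N^{m-r} D^r f`. -/
def seed (k l : ℤ) (m N : ℕ) (f : ℍ → ℂ) : ℍ → ℂ := fun τ ↦
  qPow N τ * ∑ r ∈ Finset.range (m + 1), (-1) ^ r * ((Ring.choose (k + m - 1) (m - r) : ℤ) : ℂ) *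
    ((Ring.choose (l + m - 1) r : ℤ) : ℂ) * (N : ℂ) ^ (m - r) * iterD r f τ

/-- For even weight and a function of period one, `φ ∣_w M` depends only on the coset `Γ_∞ M`. -/
theorem poincareTerm_mk {w : ℤ} (hw : Even w) {φ : ℍ → ℂ}
    (hφ : ∀ τ : ℍ, φ ((1 : ℝ) +ᵥ τ) = φ τ) (M : SL(2, ℤ)) :
    poincareTerm w φ (Quotient.mk _ M) = φ ∣[w] M := by
  have hden : ∀ τ : ℍ, denom (ModularGroup.T : GL (Fin 2) ℝ) τ = 1 := fun τ ↦ by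
    rw [ModularGroup.denom_apply]
    simp [ModularGroup.T]
  have hT : φ ∣[w] ModularGroup.T = φ := by
    ext τ
    rw [ModularForm.SL_slash_apply, hden, one_zpow, mul_one,
      UpperHalfPlane.modular_T_smul, hφ]
  have hneg : φ ∣[w] (-ModularGroup.T) = φ := by
    ext τ
    have hd : denom (↑(-ModularGroup.T) : GL (Fin 2) ℝ) τ = -1 := by
      rw [ModularGroup.denom_apply, Matrix.SpecialLinearGroup.coe_neg]
      simp [ModularGroup.T]
    rw [ModularForm.SL_slash_apply, hd, hw.neg.neg_one_zpow, mul_one,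
      ModularGroup.SL_neg_smul, UpperHalfPlane.modular_T_smul, hφ]
  have hstab : ∀ g ∈ GammaInfty, φ ∣[w] g = φ := by
    intro g hg
    induction hg using Subgroup.closure_induction with
    | mem x hx => rcases hx with rfl | rfl <;> assumption
    | one => exact SlashAction.slash_one _ _
    | mul x y _ _ hx hy => rw [SlashAction.slash_mul, hx, hy]
    | inv x _ hx =>
      conv_lhs => rw [← hx]
      rw [← SlashAction.slash_mul, mul_inv_cancel, SlashAction.slash_one]
  have hrel : QuotientGroup.rightRel GammaInfty (Quotient.mk _ M : Cosets).out M :=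
    Quotient.mk_out M
  rw [QuotientGroup.rightRel_apply] at hrel
  have h1 := hstab _ hrel
  unfold poincareTerm
  conv_lhs => rw [← h1]
  rw [← SlashAction.slash_mul, inv_mul_cancel_right]

end RankinCohenPoincare

end

/-!
Write `w = k + l + 2 m`. The seed `φ` is the bracket `[f, q ^ N]_m`
(`seed_eq_rankinCohen`). The Rankin–Cohen bracket commutes with the slash action of `SL₂(ℤ)`
(`rankinCohen_slash`), because `D ^ a (f ∣ M) / a!` arises from the `D ^ i f ∣ M` by multiplying
generating series with `exp (-γ X)`, where `γ` is the logarithmic derivative of the automorphy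
factor, and the alternating signs of the bracket cancel `exp (-γ X)` against `exp (γ X)`. As
`f ∣ M = f`, this gives `φ ∣ M = [f, q ^ N ∣ M]_m`. The series of all derivatives of `q ^ N ∣ M`
over `Γ_∞ \ Γ` are dominated on compact sets by `∑ ‖(c, d)‖ ^ (-l)` with `l ≥ 4`, so that the
bracket may be taken termwise (`locallyDominated_poincareTerm_seed`, `rankinCohen_poincareSeries`).

For the sum `∑ aₙ P_{w,n}` over the Fourier coefficients of `φ`, the interchange with the sum over
cosets needs care: the double series need not converge absolutely. Two facts replace this.

* The series `∑ aₙ P_{w,n}(τ)` converges absolutely. Estimating `P_{w,n}(τ)` term by term does not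
  suffice; but for fixed `τ` the numbers `n ^ (w - 1) P_{w,n}(τ)` are, up to a constant factor, the
  Fourier coefficients in `z` of the cusp form
  `∑_{(a b; c d) ∈ SL₂(ℤ)} (c τ z + d z + a τ + b) ^ (-w)` of weight `w`. Hecke's bound for this
  form and Bessel's inequality give `∑ n ^ (w / 2 - 2) |P_{w,n}(τ)| < ∞`
  (`summable_pow_mul_norm_poincareSeries`). On the other hand `aₙ = O (n ^ (m + e))` with
  `2 e + 4 ≤ k + l` (`exists_coeff_isBigO`, `seedCoeff_isBigO`); this is where `l ≥ k + 2` enters if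
  `f` is not a cusp form.
* Its value is found by Abel summation: with the convergence factor `e ^ (-2 π n ε)` the interchange
  is legitimate, and turns the series into `∑_M (c τ + d) ^ (-w) φ (M τ + i ε)`. Here `ε → 0` may be
  taken under the sum, since the terms are dominated by a multiple of `|c τ + d| ^ (-l)`
  (`LatticeBound.exists_bound_addPoint`): the derivatives `D ^ r f` at `z` are controlled by `Im z`
  and by the minimum of `|c z + d|`, neither of which decreases when `z` moves upwards.
-/

noncomputable section

namespace RankinCohenPoincare

open Finset
open scoped Derivative

/-! ### Derivatives of slashed functions -/

lemma iterD_zero (f : ℍ → ℂ) : iterD 0 f = f := rfl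

lemma iterD_succ (r : ℕ) (f : ℍ → ℂ) : iterD (r + 1) f = D (iterD r f) :=
  Function.iterate_succ_apply' _ _ _

lemma mdifferentiable_iterD {f : ℍ → ℂ} (hf : MDiff f) (r : ℕ) : MDiff (iterD r f) := by
  induction r with
  | zero => exact hf
  | succ r ih =>
    rw [iterD_succ]
    exact Derivative.normalizedDerivOfComplex_mdifferentiable ih

lemma mdifferentiable_slash {f : ℍ → ℂ} (hf : MDiff f) (k : ℤ) (M : SL(2, ℤ)) :
    MDiff (f ∣[k] M) :=
  hf.slash k M

lemma mdifferentiable_sum {ι : Type*} (s : Finset ι) {F : ι → ℍ → ℂ} (hF : ∀ i, MDiff (F i)) :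
    MDiff (∑ i ∈ s, F i) := by
  classical
  induction s using Finset.induction_on with
  | empty => exact mdifferentiable_const (c := (0 : ℂ))
  | insert a s ha ih => rw [sum_insert ha]; exact (hF a).add ih

lemma normalizedDeriv_zero : D (0 : ℍ → ℂ) = 0 :=
  Derivative.normalizedDerivOfComplex_const 0

lemma normalizedDeriv_sum {ι : Type*} (s : Finset ι) (c : ι → ℂ) {F : ι → ℍ → ℂ}
    (hF : ∀ i, MDiff (F i)) : D (∑ i ∈ s, c i • F i) = ∑ i ∈ s, c i • D (F i) := by
  classical
  induction s using Finset.induction_on with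
  | empty => simpa using! normalizedDeriv_zero
  | insert a s ha ih =>
    rw [sum_insert ha, sum_insert ha, Derivative.normalizedDerivOfComplex_add,
      Derivative.normalizedDerivOfComplex_smul _ _ (hF a), ih]
    · exact (hF a).const_smul _
    · exact mdifferentiable_sum s fun i ↦ (hF i).const_smul _

/-- The logarithmic derivative `(2 π i)⁻¹ c / (c τ + d)` of the automorphy factor of `M`. -/
def logFactor (M : SL(2, ℤ)) : ℍ → ℂ :=
  fun τ ↦ (2 * Real.pi * Complex.I)⁻¹ * (M 1 0 / denom M τ)

lemma logFactor_eq_slash (M : SL(2, ℤ)) :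
    logFactor M =
      ((2 * Real.pi * Complex.I)⁻¹ * (M 1 0 : ℂ)) • ((fun _ ↦ 1 : ℍ → ℂ) ∣[(1 : ℤ)] M) := by
  ext τ
  simp [logFactor, ModularForm.SL_slash_apply, div_eq_mul_inv, mul_assoc]

lemma mdifferentiable_logFactor (M : SL(2, ℤ)) : MDiff (logFactor M) := by
  rw [logFactor_eq_slash]
  exact (mdifferentiable_slash mdifferentiable_const _ _).const_smul _

lemma normalizedDeriv_slash {f : ℍ → ℂ} (hf : MDiff f) (k : ℤ) (M : SL(2, ℤ)) :
    D (f ∣[k] M) = (D f ∣[k + 2] M) - (k : ℂ) • (logFactor M * (f ∣[k] M)) := by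
  rw [Derivative.normalizedDerivOfComplex_SL_slash hf]
  ext τ
  simp [logFactor, mul_assoc]

lemma normalizedDeriv_logFactor (M : SL(2, ℤ)) : D (logFactor M) = -logFactor M ^ 2 := by
  conv_lhs => rw [logFactor_eq_slash]
  rw [Derivative.normalizedDerivOfComplex_smul _ _
      (mdifferentiable_slash mdifferentiable_const _ _),
    normalizedDeriv_slash mdifferentiable_const, Derivative.normalizedDerivOfComplex_const,
    SlashAction.zero_slash, zero_sub, Int.cast_one, one_smul, smul_neg, ← mul_smul_comm,
    ← logFactor_eq_slash, sq]

/-- The coefficient of `(-logFactor M) ^ (a - i) * (D ^ i f ∣[k + 2 i] M)` in the expansion of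
`D ^ a (f ∣[k] M)`. -/
def slashCoeff (k : ℤ) (a i : ℕ) : ℂ := (a.choose i : ℂ) * ∏ t ∈ Ico i a, ((k : ℂ) + t)

lemma slashCoeff_succ_zero (k : ℤ) (a : ℕ) :
    slashCoeff k (a + 1) 0 = slashCoeff k a 0 * (k + a) := by
  simp [slashCoeff, prod_range_succ]

lemma slashCoeff_self_succ (k : ℤ) (a : ℕ) : slashCoeff k a (a + 1) = 0 := by
  simp [slashCoeff]

lemma slashCoeff_succ_succ (k : ℤ) {a i : ℕ} (hi : i ≤ a) :
    slashCoeff k (a + 1) (i + 1) =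
      slashCoeff k a (i + 1) * (k + a + (i + 1)) + slashCoeff k a i := by
  unfold slashCoeff
  rcases hi.lt_or_eq with hi | rfl
  · rw [prod_Ico_succ_top (by omega), prod_eq_prod_Ico_succ_bot hi]
    have h1 : ((a.choose (i + 1) : ℕ) : ℂ) * (i + 1) = a.choose i * ((a : ℂ) - i) := by
      have := Nat.choose_succ_right_eq a i
      have h2 : ((a - i : ℕ) : ℂ) = (a : ℂ) - i := by push_cast [hi.le]; ring
      rw [← h2]
      exact_mod_cast this
    rw [Nat.choose_succ_succ]
    push_cast
    linear_combination (-∏ t ∈ Ico (i + 1) a, ((k : ℂ) + t)) * h1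
  · simp

/-- The failure of `D ^ a` to commute with the slash action: the quasimodular expansion of
`D ^ a (f ∣[k] M)`. -/
lemma iterD_slash {f : ℍ → ℂ} (hf : MDiff f) (k : ℤ) (M : SL(2, ℤ)) (a : ℕ) :
    iterD a (f ∣[k] M) = ∑ i ∈ range (a + 1), slashCoeff k a i •
      ((-logFactor M) ^ (a - i) * (iterD i f ∣[k + 2 * i] M)) := by
  have hX (i : ℕ) : MDiff (iterD i f ∣[k + 2 * i] M) :=
    mdifferentiable_slash (mdifferentiable_iterD hf i) _ _
  have hγ : MDiff (-logFactor M) := (mdifferentiable_logFactor M).neg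
  have hDγ : D (-logFactor M) = (-logFactor M) ^ 2 := by
    rw [Derivative.normalizedDerivOfComplex_neg _ (mdifferentiable_logFactor M),
      normalizedDeriv_logFactor, neg_neg, neg_sq]
  induction a with
  | zero => simp [slashCoeff, iterD_zero]
  | succ a ih =>
    rw [iterD_succ, ih, normalizedDeriv_sum _ _ fun i ↦ (hγ.pow _).mul (hX i)]
    have step (i : ℕ) (hi : i ∈ range (a + 1)) :
        slashCoeff k a i • D ((-logFactor M) ^ (a - i) * (iterD i f ∣[k + 2 * i] M)) =
        (slashCoeff k a i * (k + a + i)) •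
          ((-logFactor M) ^ (a + 1 - i) * (iterD i f ∣[k + 2 * i] M)) +
        slashCoeff k a i • ((-logFactor M) ^ (a - i) *
          (iterD (i + 1) f ∣[k + 2 * (i + 1 : ℕ)] M)) := by
      have hi' : i ≤ a := by simpa [Nat.lt_succ_iff] using hi
      obtain ⟨n, rfl⟩ := Nat.exists_eq_add_of_le hi'
      have e1 : i + n - i = n := by omega
      have e2 : i + n + 1 - i = n + 1 := by omega
      have e3 : k + 2 * ((i + 1 : ℕ) : ℤ) = k + 2 * i + 2 := by push_cast; ring
      rw [Derivative.normalizedDerivOfComplex_mul _ _ (hγ.pow _) (hX i),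
        Derivative.normalizedDerivOfComplex_pow _ _ hγ, hDγ,
        normalizedDeriv_slash (mdifferentiable_iterD hf i), e1, e2, e3, ← iterD_succ]
      ext τ
      simp only [Pi.smul_apply, Pi.add_apply, Pi.mul_apply, Pi.pow_apply, Pi.sub_apply,
        Pi.neg_apply, smul_eq_mul, Pi.natCast_apply]
      push_cast
      rcases n with _ | n
      · simp; ring
      · simp only [Nat.add_sub_cancel]; push_cast; ring
    rw [sum_congr rfl step, sum_add_distrib, sum_range_succ' _ (a + 1)]
    have h1 : ∑ i ∈ range (a + 1), slashCoeff k (a + 1) (i + 1) •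
        ((-logFactor M) ^ (a + 1 - (i + 1)) * (iterD (i + 1) f ∣[k + 2 * (i + 1 : ℕ)] M)) =
        ∑ i ∈ range (a + 1), (slashCoeff k a (i + 1) * (k + a + (i + 1 : ℕ))) •
        ((-logFactor M) ^ (a + 1 - (i + 1)) * (iterD (i + 1) f ∣[k + 2 * (i + 1 : ℕ)] M)) +
        ∑ i ∈ range (a + 1), slashCoeff k a i •
        ((-logFactor M) ^ (a - i) * (iterD (i + 1) f ∣[k + 2 * (i + 1 : ℕ)] M)) := by
      rw [← sum_add_distrib]
      refine sum_congr rfl fun i hi ↦ ?_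
      rw [slashCoeff_succ_succ k (by simpa [Nat.lt_succ_iff] using hi), add_smul,
        Nat.add_sub_add_right]
      push_cast
      rfl
    rw [h1, add_right_comm]
    congr 1
    have h2 := sum_range_succ' (fun i ↦ (slashCoeff k a i * (k + a + i)) •
      ((-logFactor M) ^ (a + 1 - i) * (iterD i f ∣[k + 2 * i] M))) (a + 1)
    rw [sum_range_succ, slashCoeff_self_succ, zero_mul, zero_smul, add_zero] at h2
    rw [h2, slashCoeff_succ_zero]
    simp

/-! ### Covariance of the Rankin–Cohen bracket -/

lemma factorial_mul_choose (r : ℤ) (n : ℕ) :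
    (n.factorial : ℤ) * Ring.choose (r + n - 1) n = ∏ t ∈ range n, (r + t) := by
  have := Ring.factorial_nsmul_multichoose_eq_ascPochhammer r n
  have h (n : ℕ) : (ascPochhammer ℤ n).eval r = ∏ t ∈ range n, (r + t) := by
    induction n with
    | zero => simp
    | succ n ih => rw [ascPochhammer_succ_eval, ih, prod_range_succ]
  rw [Ring.multichoose_eq, Polynomial.ascPochhammer_smeval_eq_eval, h] at this
  simpa using this

lemma choose_eq_prod_div (k : ℤ) {m a : ℕ} (ha : a ≤ m) :
    ((Ring.choose (k + m - 1) (m - a) : ℤ) : ℂ) =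
      (∏ t ∈ Ico a m, ((k : ℂ) + t)) / ((m - a).factorial : ℂ) := by
  have h := congrArg (Int.cast : ℤ → ℂ) (factorial_mul_choose (k + a) (m - a))
  have e : k + a + ((m - a : ℕ) : ℤ) - 1 = k + m - 1 := by push_cast [ha]; ring
  rw [e] at h
  rw [eq_div_iff (by exact_mod_cast Nat.factorial_ne_zero _), mul_comm, prod_Ico_eq_prod_range]
  push_cast at h ⊢
  rw [h]
  exact prod_congr rfl fun t _ ↦ by ring

/-- The cancellation behind the covariance of the Rankin–Cohen bracket: twisting both sequences by
`exp (-γ X)` leaves the coefficients of the product `x (-X) y (X)` of their generating series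
unchanged. -/
lemma sum_twist_mul_twist (γ : ℂ) (x y : ℕ → ℂ) (m : ℕ) :
    ∑ a ∈ range (m + 1), (-1) ^ a *
      (∑ i ∈ range (a + 1), x i * ((-γ) ^ (a - i) / (a - i).factorial)) *
      (∑ j ∈ range (m - a + 1), y j * ((-γ) ^ (m - a - j) / (m - a - j).factorial)) =
    ∑ a ∈ range (m + 1), (-1) ^ a * x a * y (m - a) := by
  let E : PowerSeries ℂ := PowerSeries.rescale (-γ) (PowerSeries.exp ℂ)
  have hE : PowerSeries.evalNegHom E * E = 1 := by
    have h := PowerSeries.exp_mul_exp_neg_eq_one (A := ℂ)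
    have := congrArg (PowerSeries.rescale γ) h
    rw [map_mul, map_one] at this
    convert! this using 2 <;> ext n <;>
      simp [E, PowerSeries.evalNegHom, PowerSeries.coeff_rescale, neg_pow γ] <;> ring_nf <;> simp
  have hEc (n : ℕ) : PowerSeries.coeff n E = (-γ) ^ n / n.factorial := by
    simp [E, PowerSeries.coeff_rescale, PowerSeries.coeff_exp, div_eq_mul_inv]
  have htw (z : ℕ → ℂ) (a : ℕ) : PowerSeries.coeff a (PowerSeries.mk z * E) =
      ∑ i ∈ range (a + 1), z i * ((-γ) ^ (a - i) / (a - i).factorial) := by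
    rw [PowerSeries.coeff_mul, Nat.sum_antidiagonal_eq_sum_range_succ_mk]
    simp [hEc]
  have key : PowerSeries.evalNegHom (PowerSeries.mk x * E) * (PowerSeries.mk y * E) =
      PowerSeries.evalNegHom (PowerSeries.mk x) * PowerSeries.mk y := by
    rw [map_mul]
    linear_combination (PowerSeries.evalNegHom (PowerSeries.mk x) * PowerSeries.mk y) * hE
  have hneg (p : PowerSeries ℂ) (a : ℕ) : PowerSeries.coeff a (PowerSeries.evalNegHom p) =
      (-1) ^ a * PowerSeries.coeff a p := PowerSeries.coeff_rescale _ _ _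
  have := congrArg (PowerSeries.coeff m) key
  rw [PowerSeries.coeff_mul, PowerSeries.coeff_mul, Nat.sum_antidiagonal_eq_sum_range_succ_mk,
    Nat.sum_antidiagonal_eq_sum_range_succ_mk] at this
  simpa only [hneg, htw, PowerSeries.coeff_mk] using this

/-- The term `∏_{a ≤ t < m} (k + t) D ^ a f / a!`; the Rankin–Cohen bracket is the alternating
convolution of these normalized derivatives. -/
def bracketTerm (k : ℤ) (m : ℕ) (f : ℍ → ℂ) (a : ℕ) (τ : ℍ) : ℂ :=
  (∏ t ∈ Ico a m, ((k : ℂ) + t)) / (a.factorial : ℂ) * iterD a f τ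

lemma rankinCohen_eq_sum_bracketTerm (k l : ℤ) (m : ℕ) (f g : ℍ → ℂ) (τ : ℍ) :
    rankinCohen k l m f g τ = ∑ a ∈ range (m + 1),
      (-1) ^ a * bracketTerm k m f a τ * bracketTerm l m g (m - a) τ := by
  refine sum_congr rfl fun a ha ↦ ?_
  have ha' : a ≤ m := by simpa [Nat.lt_succ_iff] using ha
  have h := choose_eq_prod_div l (Nat.sub_le m a)
  rw [Nat.sub_sub_self ha'] at h
  rw [choose_eq_prod_div k ha', h, bracketTerm, bracketTerm]
  ring

lemma bracketTerm_slash {f : ℍ → ℂ} (hf : MDiff f) (k : ℤ) (M : SL(2, ℤ)) {m a : ℕ} (ha : a ≤ m)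
    (τ : ℍ) : bracketTerm k m (f ∣[k] M) a τ = ∑ i ∈ range (a + 1),
      bracketTerm k m f i (M • τ) * denom M τ ^ (-(k + 2 * i)) *
        ((-logFactor M τ) ^ (a - i) / (a - i).factorial) := by
  rw [bracketTerm, iterD_slash hf, Finset.sum_apply, mul_sum]
  refine sum_congr rfl fun i hi ↦ ?_
  have hi' : i ≤ a := by simpa [Nat.lt_succ_iff] using hi
  rw [bracketTerm, ← prod_Ico_consecutive (fun t : ℕ ↦ (k : ℂ) + t) hi' ha]
  have hc : (a.choose i : ℂ) = a.factorial / (i.factorial * (a - i).factorial) :=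
    Nat.cast_choose ℂ hi'
  simp only [Pi.smul_apply, Pi.mul_apply, Pi.pow_apply, Pi.neg_apply, smul_eq_mul, slashCoeff,
    ModularForm.SL_slash_apply, hc]
  have : (a.factorial : ℂ) ≠ 0 := by exact_mod_cast Nat.factorial_ne_zero _
  field_simp

/-- The bracket commutes with the slash action for holomorphic functions: no modularity of `f` or
`g` is assumed. -/
theorem rankinCohen_slash {f g : ℍ → ℂ} (hf : MDiff f) (hg : MDiff g) (k l : ℤ) (m : ℕ)
    (M : SL(2, ℤ)) : rankinCohen k l m (f ∣[k] M) (g ∣[l] M) =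
      rankinCohen k l m f g ∣[k + l + 2 * m] M := by
  ext τ
  rw [ModularForm.SL_slash_apply, rankinCohen_eq_sum_bracketTerm, rankinCohen_eq_sum_bracketTerm,
    sum_mul]
  have h := sum_twist_mul_twist (logFactor M τ)
    (fun i ↦ bracketTerm k m f i (M • τ) * denom M τ ^ (-(k + 2 * i)))
    (fun j ↦ bracketTerm l m g j (M • τ) * denom M τ ^ (-(l + 2 * j))) m
  refine Eq.trans (sum_congr rfl fun a ha ↦ ?_) (h.trans (sum_congr rfl fun a ha ↦ ?_))
  · have ha' : a ≤ m := by simpa [Nat.lt_succ_iff] using ha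
    rw [bracketTerm_slash hf k M ha', bracketTerm_slash hg l M (Nat.sub_le m a)]
  · have ha' : a ≤ m := by simpa [Nat.lt_succ_iff] using ha
    have e : -(k + l + 2 * m) = -(k + 2 * a) + -(l + 2 * (m - a : ℕ)) := by
      push_cast [ha']; ring
    rw [e, zpow_add₀ (denom_ne_zero _ τ)]
    ring

/-! ### Powers of `q` -/

lemma mdifferentiable_qPow (N : ℕ) : MDiff (qPow N) := by
  rw [UpperHalfPlane.mdifferentiable_iff]
  have : DifferentiableOn ℂ (fun z : ℂ ↦ Complex.exp (2 * Real.pi * Complex.I * z) ^ N)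
      upperHalfPlaneSet := by
    fun_prop
  refine this.congr fun z hz ↦ ?_
  simp [qPow, ofComplex_apply_of_im_pos hz]

lemma normalizedDeriv_qPow (N : ℕ) : D (qPow N) = (N : ℂ) • qPow N := by
  ext τ
  have hd : HasDerivAt (fun z : ℂ ↦ Complex.exp (2 * Real.pi * Complex.I * z) ^ N)
      (N * Complex.exp (2 * Real.pi * Complex.I * τ) ^ N * (2 * Real.pi * Complex.I)) (τ : ℂ) := by
    have h1 : HasDerivAt (fun z : ℂ ↦ Complex.exp (N * (2 * Real.pi * Complex.I * z)))
        (Complex.exp (N * (2 * Real.pi * Complex.I * τ)) * (N * (2 * Real.pi * Complex.I * 1)))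
        (τ : ℂ) :=
      (((hasDerivAt_id (τ : ℂ)).const_mul (2 * Real.pi * Complex.I)).const_mul (N : ℂ)).cexp
    simp only [Complex.exp_nat_mul] at h1
    convert! h1 using 1
    ring
  have he : (qPow N ∘ ofComplex) =ᶠ[nhds (τ : ℂ)]
      fun z ↦ Complex.exp (2 * Real.pi * Complex.I * z) ^ N := by
    filter_upwards [isOpen_upperHalfPlaneSet.mem_nhds τ.im_pos] with w hw
    simp [qPow, ofComplex_apply_of_im_pos hw]
  rw [Derivative.normalizedDerivOfComplex, he.deriv_eq, hd.deriv]
  have : (2 * Real.pi * Complex.I : ℂ) ≠ 0 := Complex.two_pi_I_ne_zero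
  simp only [Pi.smul_apply, smul_eq_mul, qPow]
  field_simp

lemma iterD_qPow (N r : ℕ) : iterD r (qPow N) = (N : ℂ) ^ r • qPow N := by
  induction r with
  | zero => simp [iterD_zero]
  | succ r ih =>
    rw [iterD_succ, ih, Derivative.normalizedDerivOfComplex_smul _ _ (mdifferentiable_qPow N),
      normalizedDeriv_qPow, smul_smul, pow_succ]

/-- The seed is the Rankin–Cohen bracket of `f` with `q ^ N`. -/
lemma seed_eq_rankinCohen (k l : ℤ) (m N : ℕ) (f : ℍ → ℂ) :
    seed k l m N f = rankinCohen k l m f (qPow N) := by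
  ext τ
  rw [seed, rankinCohen, mul_sum]
  refine sum_congr rfl fun r _ ↦ ?_
  rw [iterD_qPow]
  simp only [Pi.smul_apply, smul_eq_mul]
  ring

/-! ### Locally dominated series -/

/-- The series `∑ G i` of functions on `ℍ` is dominated, on each compact set, by a summable
sequence of constants. -/
def LocallyDominated {ι : Type*} (G : ι → ℍ → ℂ) : Prop :=
  ∀ K : Set ℍ, IsCompact K → ∃ u : ι → ℝ, Summable u ∧ ∀ i, ∀ τ ∈ K, ‖G i τ‖ ≤ u i

lemma LocallyDominated.summable_norm {ι : Type*} {G : ι → ℍ → ℂ} (hG : LocallyDominated G)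
    (τ : ℍ) : Summable fun i ↦ ‖G i τ‖ := by
  obtain ⟨u, hu, h⟩ := hG {τ} isCompact_singleton
  exact hu.of_nonneg_of_le (fun _ ↦ norm_nonneg _) fun i ↦ h i τ rfl

lemma LocallyDominated.hasSumLocallyUniformly {ι : Type*} {G : ι → ℍ → ℂ}
    (hG : LocallyDominated G) : HasSumLocallyUniformly G fun τ ↦ ∑' i, G i τ := by
  refine hasSumLocallyUniformly_of_forall_compact fun K hK ↦ ?_
  obtain ⟨u, hu, h⟩ := hG K hK
  exact HasSumUniformlyOn.of_norm_le_summable hu h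

lemma LocallyDominated.mdifferentiable_and_hasSum_normalizedDeriv {ι : Type*} {G : ι → ℍ → ℂ}
    (hG : LocallyDominated G) (hd : ∀ i, MDiff (G i)) :
    MDiff (fun τ ↦ ∑' i, G i τ) ∧
      ∀ τ, HasSum (fun i ↦ D (G i) τ) (D (fun τ ↦ ∑' i, G i τ) τ) := by
  have key (τ : ℍ) : ∃ U : Set ℂ, IsOpen U ∧ (τ : ℂ) ∈ U ∧ U ⊆ upperHalfPlaneSet ∧
      ∃ u : ι → ℝ, Summable u ∧ ∀ i, ∀ w ∈ U, ‖(G i ∘ ofComplex) w‖ ≤ u i := by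
    obtain ⟨K, hK, hτ⟩ := exists_compact_mem_nhds τ
    obtain ⟨u, hu, h⟩ := hG K hK
    refine ⟨(↑) '' interior K, isOpenEmbedding_coe.isOpenMap _ isOpen_interior,
      ⟨τ, mem_interior_iff_mem_nhds.mpr hτ, rfl⟩, ?_, u, hu, ?_⟩
    · rintro _ ⟨z, -, rfl⟩
      exact z.im_pos
    · rintro i _ ⟨z, hz, rfl⟩
      simpa using h i z (interior_subset hz)
  have hdiff (i : ι) : DifferentiableOn ℂ (G i ∘ ofComplex) upperHalfPlaneSet :=
    UpperHalfPlane.mdifferentiable_iff.mp (hd i)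
  constructor
  · intro τ
    obtain ⟨U, hU, hτ, hUH, u, hu, h⟩ := key τ
    rw [UpperHalfPlane.mdifferentiableAt_iff]
    exact (Complex.differentiableOn_tsum_of_summable_norm hu (fun i ↦ (hdiff i).mono hUH) hU
      h).differentiableAt (hU.mem_nhds hτ)
  · intro τ
    obtain ⟨U, hU, hτ, hUH, u, hu, h⟩ := key τ
    exact (Complex.hasSum_deriv_of_summable_norm hu (fun i ↦ (hdiff i).mono hUH) hU h hτ).mul_left _

lemma iterD_tsum {ι : Type*} {G : ι → ℍ → ℂ} (hd : ∀ i, MDiff (G i))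
    (hG : ∀ r, LocallyDominated fun i ↦ iterD r (G i)) (r : ℕ) :
    iterD r (fun τ ↦ ∑' i, G i τ) = fun τ ↦ ∑' i, iterD r (G i) τ := by
  induction r with
  | zero => rfl
  | succ r ih =>
    ext τ
    rw [iterD_succ, ih]
    simp only [iterD_succ]
    exact (((hG r).mdifferentiable_and_hasSum_normalizedDeriv
      fun i ↦ mdifferentiable_iterD (hd i) r).2 τ).tsum_eq.symm

/-! ### The cosets `Γ_∞ \ Γ` -/

lemma row_ne_zero (M : SL(2, ℤ)) : M.1 1 ≠ 0 := by
  intro h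
  have hdet := M.det_coe
  rw [Matrix.det_fin_two] at hdet
  simp [h] at hdet

lemma one_le_norm_of_ne_zero {v : Fin 2 → ℤ} (hv : v ≠ 0) : 1 ≤ ‖v‖ := by
  obtain ⟨i, hi⟩ := Function.ne_iff.mp hv
  have h1 : (1 : ℝ) ≤ ‖v i‖ := by
    rw [Int.norm_eq_abs]
    exact_mod_cast Int.one_le_abs hi
  exact h1.trans (norm_le_pi_norm v i)

lemma norm_row_pos (M : SL(2, ℤ)) : 0 < ‖M.1 1‖ :=
  zero_lt_one.trans_le (one_le_norm_of_ne_zero (row_ne_zero M))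

lemma r_mul_norm_row_le (M : SL(2, ℤ)) (τ : ℍ) :
    EisensteinSeries.r τ * ‖M.1 1‖ ≤ ‖denom M τ‖ :=
  EisensteinSeries.r_mul_max_le τ (row_ne_zero M)

lemma norm_denom_pos (M : SL(2, ℤ)) (τ : ℍ) : 0 < ‖denom M τ‖ :=
  norm_pos_iff.mpr (denom_ne_zero _ τ)

lemma exists_eq_T_zpow_or {g : SL(2, ℤ)} (hg : g 1 0 = 0) :
    ∃ n : ℤ, g = ModularGroup.T ^ n ∨ g = -ModularGroup.T ^ n := by
  have hdet := g.det_coe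
  rw [Matrix.det_fin_two, hg, mul_zero, sub_zero] at hdet
  rcases Int.eq_one_or_neg_one_of_mul_eq_one hdet with h | h
  · rw [h, one_mul] at hdet
    refine ⟨g 0 1, Or.inl ?_⟩
    ext i j
    rw [ModularGroup.coe_T_zpow]
    fin_cases i <;> fin_cases j <;> simp [h, hg, hdet]
  · rw [h] at hdet
    refine ⟨-g 0 1, Or.inr ?_⟩
    ext i j
    rw [Matrix.SpecialLinearGroup.coe_neg, ModularGroup.coe_T_zpow]
    fin_cases i <;> fin_cases j <;> simp [h, hg]; linarith

/-- The group generated by `± T` consists of all `M` with lower left entry zero. -/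
lemma mem_GammaInfty_iff {g : SL(2, ℤ)} : g ∈ GammaInfty ↔ g 1 0 = 0 := by
  constructor
  · intro h
    induction h using Subgroup.closure_induction with
    | mem x hx =>
      rcases hx with rfl | rfl
      · simp [ModularGroup.T]
      · rw [Matrix.SpecialLinearGroup.coe_neg]
        simp [ModularGroup.T]
    | one => simp
    | mul x y _ _ hx hy =>
      rw [Matrix.SpecialLinearGroup.coe_mul, Matrix.mul_apply, Fin.sum_univ_two, hx, hy]
      simp
    | inv x _ hx => simp [Matrix.SpecialLinearGroup.SL2_inv_expl, hx]
  · intro h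
    have hT : ModularGroup.T ∈ GammaInfty := Subgroup.subset_closure (by simp)
    have hT' : -ModularGroup.T ∈ GammaInfty := Subgroup.subset_closure (by simp)
    have hneg : -1 ∈ GammaInfty := by
      simpa using GammaInfty.mul_mem hT' (GammaInfty.inv_mem hT)
    obtain ⟨n, rfl | rfl⟩ := exists_eq_T_zpow_or h
    · exact GammaInfty.zpow_mem hT n
    · simpa using GammaInfty.mul_mem hneg (GammaInfty.zpow_mem hT n)

lemma coset_eq_of_mul_inv_mem {c c' : Cosets} (h : c'.out * c.out⁻¹ ∈ GammaInfty) : c = c' := by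
  rw [← c.out_eq, ← c'.out_eq, Quotient.eq, QuotientGroup.rightRel_apply]
  exact h

/-- A coset `Γ_∞ M` is determined by the bottom row of `M`. -/
lemma injective_row : Function.Injective fun c : Cosets ↦ c.out.1 1 := by
  intro c c' h
  refine coset_eq_of_mul_inv_mem (mem_GammaInfty_iff.mpr ?_)
  have h0 : c.out 1 0 = c'.out 1 0 := congrFun h 0
  have h1 : c.out 1 1 = c'.out 1 1 := congrFun h 1
  rw [Matrix.SpecialLinearGroup.coe_mul, Matrix.mul_apply, Fin.sum_univ_two]
  simp [Matrix.SpecialLinearGroup.SL2_inv_expl, h0, h1, mul_comm]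

lemma summable_norm_row {l : ℕ} (hl : 3 ≤ l) :
    Summable fun c : Cosets ↦ (‖c.out.1 1‖ ^ l)⁻¹ := by
  have h := EisensteinSeries.summable_one_div_norm_rpow (k := l) (by exact_mod_cast hl)
  refine (h.comp_injective injective_row).congr fun c ↦ ?_
  simp [Real.rpow_neg]

lemma summable_norm_denom {l : ℕ} (hl : 3 ≤ l) (τ : ℍ) :
    Summable fun c : Cosets ↦ (‖denom c.out τ‖ ^ l)⁻¹ := by
  refine ((summable_norm_row hl).mul_left (EisensteinSeries.r τ ^ l)⁻¹).of_nonneg_of_le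
    (fun c ↦ by positivity) fun c ↦ ?_
  have h0 := EisensteinSeries.r_pos τ
  have h1 := norm_row_pos c.out
  rw [← mul_inv, ← mul_pow]
  gcongr
  exact r_mul_norm_row_le _ _

/-! ### Domination of the series over cosets -/

lemma norm_qPow_le_one (N : ℕ) (τ : ℍ) : ‖qPow N τ‖ ≤ 1 := by
  rw [qPow, norm_pow]
  exact pow_le_one₀ (norm_nonneg _) (UpperHalfPlane.norm_exp_two_pi_I_lt_one τ).le

lemma norm_logFactor_mul_le (M : SL(2, ℤ)) (τ : ℍ) :
    EisensteinSeries.r τ * ‖logFactor M τ‖ ≤ 1 := by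
  have h1 := r_mul_norm_row_le M τ
  have h2 : ‖(M 1 0 : ℂ)‖ ≤ ‖M.1 1‖ := by
    rw [Complex.norm_intCast, ← Int.norm_eq_abs]
    exact norm_le_pi_norm (M.1 1) 0
  have h3 : (1 : ℝ) ≤ ‖(2 * Real.pi * Complex.I : ℂ)‖ := by
    simp [abs_of_pos Real.pi_pos]
    linarith [Real.pi_gt_three]
  have h4 := norm_denom_pos M τ
  have h5 := EisensteinSeries.r_pos τ
  rw [logFactor, norm_mul, norm_div, norm_inv]
  calc _ ≤ EisensteinSeries.r τ * (1 * (‖M.1 1‖ / ‖denom M τ‖)) := by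
        gcongr
        exact inv_le_one_of_one_le₀ h3
    _ = (EisensteinSeries.r τ * ‖M.1 1‖) / ‖denom M τ‖ := by ring
    _ ≤ 1 := (div_le_one h4).mpr h1

lemma exists_le_r {K : Set ℍ} (hK : IsCompact K) : ∃ ρ > 0, ∀ τ ∈ K, ρ ≤ EisensteinSeries.r τ := by
  obtain ⟨A, B, hB, h⟩ := subset_verticalStrip_of_isCompact hK
  exact ⟨_, EisensteinSeries.r_pos ⟨⟨A, B⟩, hB⟩, fun τ hτ ↦
    EisensteinSeries.r_lower_bound_on_verticalStrip τ hB (h hτ)⟩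

/-- On compact sets, every derivative of `q ^ N ∣ M` is bounded by a multiple of the `-l`-th power
of the size of the bottom row of `M`, uniformly in `M`. -/
lemma exists_bound_iterD_qPow_slash (l N r : ℕ) {K : Set ℍ} (hK : IsCompact K) :
    ∃ C, ∀ M : SL(2, ℤ), ∀ τ ∈ K,
      ‖iterD r (qPow N ∣[(l : ℤ)] M) τ‖ ≤ C * (‖M.1 1‖ ^ l)⁻¹ := by
  obtain ⟨ρ, hρ, hle⟩ := exists_le_r hK
  refine ⟨∑ i ∈ range (r + 1), ‖slashCoeff l r i‖ *
    ((ρ⁻¹) ^ (r - i) * ((N : ℝ) ^ i * (ρ ^ (l + 2 * i))⁻¹)), fun M τ hτ ↦ ?_⟩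
  rw [iterD_slash (mdifferentiable_qPow N), Finset.sum_apply, sum_mul]
  refine (norm_sum_le _ _).trans (sum_le_sum fun i _ ↦ ?_)
  have hM := one_le_norm_of_ne_zero (row_ne_zero M)
  have hden : ρ * ‖M.1 1‖ ≤ ‖denom M τ‖ :=
    (mul_le_mul_of_nonneg_right (hle τ hτ) (norm_nonneg _)).trans (r_mul_norm_row_le M τ)
  have hlog : ‖logFactor M τ‖ ≤ ρ⁻¹ := by
    rw [← one_div, le_div_iff₀' hρ]
    exact (mul_le_mul_of_nonneg_right (hle τ hτ) (norm_nonneg _)).trans (norm_logFactor_mul_le M τ)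
  have e : -((l : ℤ) + 2 * i) = -((l + 2 * i : ℕ) : ℤ) := by push_cast; ring
  have hmain : ‖qPow N (M • τ)‖ * (‖denom M τ‖ ^ (l + 2 * i))⁻¹ ≤
      (ρ ^ (l + 2 * i))⁻¹ * (‖M.1 1‖ ^ l)⁻¹ := by
    calc ‖qPow N (M • τ)‖ * (‖denom M τ‖ ^ (l + 2 * i))⁻¹
        ≤ 1 * ((ρ * ‖M.1 1‖) ^ (l + 2 * i))⁻¹ := by
          gcongr
          exact norm_qPow_le_one _ _
      _ = (ρ ^ (l + 2 * i))⁻¹ * (‖M.1 1‖ ^ (l + 2 * i))⁻¹ := by rw [one_mul, mul_pow, mul_inv]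
      _ ≤ (ρ ^ (l + 2 * i))⁻¹ * (‖M.1 1‖ ^ l)⁻¹ := by
          gcongr
          omega
  rw [iterD_qPow]
  simp only [Pi.smul_apply, Pi.mul_apply, Pi.pow_apply, Pi.neg_apply, smul_eq_mul,
    ModularForm.SL_slash_apply, norm_mul, norm_pow, norm_neg, Complex.norm_natCast, mul_assoc]
  rw [e, zpow_neg, zpow_natCast, norm_inv, norm_pow]
  gcongr

lemma locallyDominated_iterD_qPow_slash {l : ℕ} (hl : 3 ≤ l) (N r : ℕ) :
    LocallyDominated fun c : Cosets ↦ iterD r (qPow N ∣[(l : ℤ)] c.out) := fun K hK ↦ by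
  obtain ⟨C, hC⟩ := exists_bound_iterD_qPow_slash l N r hK
  exact ⟨_, (summable_norm_row hl).mul_left C, fun c τ hτ ↦ hC c.out τ hτ⟩

lemma iterD_poincareSeries {l : ℕ} (hl : 3 ≤ l) (N r : ℕ) :
    iterD r (poincareSeries l N) = fun τ ↦ ∑' c : Cosets, iterD r (qPow N ∣[(l : ℤ)] c.out) τ :=
  iterD_tsum (fun _ ↦ mdifferentiable_slash (mdifferentiable_qPow N) _ _)
    (fun r ↦ locallyDominated_iterD_qPow_slash hl N r) r

lemma LocallyDominated.mul_left {ι : Type*} {G : ι → ℍ → ℂ} (hG : LocallyDominated G)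
    {F : ℍ → ℂ} (hF : Continuous F) : LocallyDominated fun i τ ↦ F τ * G i τ := fun K hK ↦ by
  obtain ⟨u, hu, h⟩ := hG K hK
  obtain ⟨C, hC⟩ := hK.exists_bound_of_continuousOn hF.continuousOn
  refine ⟨fun i ↦ C * u i, hu.mul_left C, fun i τ hτ ↦ ?_⟩
  rw [norm_mul]
  exact mul_le_mul (hC τ hτ) (h i τ hτ) (norm_nonneg _) ((norm_nonneg _).trans (hC τ hτ))

lemma LocallyDominated.sum {ι κ : Type*} (s : Finset κ) {G : κ → ι → ℍ → ℂ}
    (hG : ∀ j ∈ s, LocallyDominated (G j)) : LocallyDominated fun i τ ↦ ∑ j ∈ s, G j i τ :=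
  fun K hK ↦ by
    choose! u hu h using fun j hj ↦ hG j hj K hK
    exact ⟨fun i ↦ ∑ j ∈ s, u j i, summable_sum fun j hj ↦ hu j hj, fun i τ hτ ↦
      (norm_sum_le _ _).trans (sum_le_sum fun j hj ↦ h j hj i τ hτ)⟩

/-! ### The bracket with a Poincaré series -/

/-- The terms of the Poincaré average of the seed are brackets of `f` with the terms of the
Poincaré series. -/
lemma poincareTerm_seed {k : ℤ} {f : ℍ → ℂ} (hf : MDiff f) (hk : ∀ M : SL(2, ℤ), f ∣[k] M = f)
    (l : ℤ) (m N : ℕ) (c : Cosets) : poincareTerm (k + l + 2 * m) (seed k l m N f) c =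
      rankinCohen k l m f (qPow N ∣[l] c.out) := by
  rw [poincareTerm, seed_eq_rankinCohen, ← rankinCohen_slash hf (mdifferentiable_qPow N), hk]

lemma locallyDominated_poincareTerm_seed {k : ℤ} {f : ℍ → ℂ} (hf : MDiff f)
    (hk : ∀ M : SL(2, ℤ), f ∣[k] M = f) {l : ℕ} (hl : 3 ≤ l) (m N : ℕ) :
    LocallyDominated (poincareTerm (k + l + 2 * m) (seed k l m N f)) := by
  have h := LocallyDominated.sum (range (m + 1)) fun j _ ↦
    (locallyDominated_iterD_qPow_slash hl N (m - j)).mul_left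
      ((mdifferentiable_iterD hf j).continuous.const_smul
        ((-1) ^ j * ((Ring.choose (k + m - 1) (m - j) : ℤ) : ℂ) *
          ((Ring.choose ((l : ℤ) + m - 1) j : ℤ) : ℂ)))
  convert! h using 1
  ext c τ
  rw [poincareTerm_seed hf hk]
  rfl

lemma rankinCohen_poincareSeries {k : ℤ} {f : ℍ → ℂ} (hf : MDiff f)
    (hk : ∀ M : SL(2, ℤ), f ∣[k] M = f) {l : ℕ} (hl : 3 ≤ l) (m N : ℕ) :
    rankinCohen k l m f (poincareSeries l N) =
      poincareAverage (k + l + 2 * m) (seed k l m N f) := by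
  ext τ
  have hs (j : ℕ) := ((locallyDominated_iterD_qPow_slash hl N j).summable_norm τ).of_norm
  simp only [poincareAverage, poincareTerm_seed hf hk, rankinCohen, iterD_poincareSeries hl]
  rw [Summable.tsum_finsetSum fun j _ ↦ (hs _).mul_left _]
  exact sum_congr rfl fun j _ ↦ tsum_mul_left.symm

/-! ### Functions given by power series in `q` -/

lemma qPow_eq_qParam (n : ℕ) (τ : ℍ) : qPow n τ = Function.Periodic.qParam 1 τ ^ n := by
  simp [qPow, Function.Periodic.qParam]

lemma norm_qPow (n : ℕ) (τ : ℍ) : ‖qPow n τ‖ = Real.exp (-(2 * Real.pi * τ.im)) ^ n := by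
  rw [qPow_eq_qParam, norm_pow, Function.Periodic.norm_qParam]
  simp

lemma norm_qPow_le_of_im_le (n : ℕ) {τ τ' : ℍ} (h : τ.im ≤ τ'.im) :
    ‖qPow n τ'‖ ≤ ‖qPow n τ‖ := by
  rw [norm_qPow, norm_qPow]
  gcongr

lemma locallyDominated_qSeries {c : ℕ → ℂ} (hc : ∀ τ, Summable fun n ↦ c n * qPow n τ) :
    LocallyDominated fun n τ ↦ c n * qPow n τ := fun K hK ↦ by
  obtain ⟨A, B, hB, h⟩ := subset_verticalStrip_of_isCompact hK
  refine ⟨_, (hc ⟨⟨A, B⟩, hB⟩).norm, fun n τ hτ ↦ ?_⟩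
  rw [norm_mul, norm_mul]
  exact mul_le_mul_of_nonneg_left (norm_qPow_le_of_im_le n (h hτ).2) (norm_nonneg _)

lemma mdifferentiable_and_hasSum_normalizedDeriv_of_qSeries {c : ℕ → ℂ} {F : ℍ → ℂ}
    (hF : ∀ τ, HasSum (fun n ↦ c n * qPow n τ) (F τ)) :
    MDiff F ∧ ∀ τ, HasSum (fun n : ℕ ↦ (n * c n) * qPow n τ) (D F τ) := by
  have hd (n : ℕ) : MDiff (fun τ ↦ c n * qPow n τ) := (mdifferentiable_qPow n).const_smul (c n)
  have h := LocallyDominated.mdifferentiable_and_hasSum_normalizedDeriv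
    (locallyDominated_qSeries fun τ ↦ (hF τ).summable) hd
  have hFeq : (fun τ ↦ ∑' n, c n * qPow n τ) = F := funext fun τ ↦ (hF τ).tsum_eq
  rw [hFeq] at h
  refine ⟨h.1, fun τ ↦ ?_⟩
  convert! h.2 τ using 2 with n
  have := Derivative.normalizedDerivOfComplex_smul (c n) _ (mdifferentiable_qPow n)
  rw [normalizedDeriv_qPow] at this
  refine Eq.trans ?_ (congrFun this τ).symm
  simp only [Pi.smul_apply, smul_eq_mul]
  ring

lemma hasSum_iterD_of_qSeries {c : ℕ → ℂ} {F : ℍ → ℂ}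
    (hF : ∀ τ, HasSum (fun n ↦ c n * qPow n τ) (F τ)) (r : ℕ) (τ : ℍ) :
    HasSum (fun n : ℕ ↦ ((n : ℂ) ^ r * c n) * qPow n τ) (iterD r F τ) := by
  induction r generalizing τ with
  | zero => simpa [iterD_zero] using hF τ
  | succ r ih =>
    rw [iterD_succ]
    simpa only [pow_succ', mul_assoc] using
      (mdifferentiable_and_hasSum_normalizedDeriv_of_qSeries ih).2 τ

lemma periodic_of_qSeries {c : ℕ → ℂ} {F : ℍ → ℂ}
    (hF : ∀ τ, HasSum (fun n ↦ c n * qPow n τ) (F τ)) :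
    Function.Periodic (F ∘ ofComplex) (1 : ℝ) := by
  intro w
  by_cases hw : 0 < w.im
  · have hw' : 0 < (w + (1 : ℝ)).im := by simpa using hw
    simp only [Function.comp_apply, ofComplex_apply_of_im_pos hw, ofComplex_apply_of_im_pos hw']
    have h (n : ℕ) : qPow n ⟨w + (1 : ℝ), hw'⟩ = qPow n ⟨w, hw⟩ := by
      have h1 : 2 * Real.pi * Complex.I * (w + (1 : ℝ)) =
          2 * Real.pi * Complex.I * w + 2 * Real.pi * Complex.I := by
        push_cast
        ring
      simp only [qPow, h1, Complex.exp_periodic _]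
    have h1 := hF ⟨w + (1 : ℝ), hw'⟩
    simp only [h] at h1
    exact h1.unique (hF ⟨w, hw⟩)
  · have hw' : ¬ 0 < (w + (1 : ℝ)).im := by simpa using hw
    simp only [Function.comp_apply, ofComplex_apply_of_im_nonpos (not_lt.mp hw),
      ofComplex_apply_of_im_nonpos (not_lt.mp hw')]

lemma isBoundedAtImInfty_of_qSeries {c : ℕ → ℂ} {F : ℍ → ℂ}
    (hF : ∀ τ, HasSum (fun n ↦ c n * qPow n τ) (F τ)) : IsBoundedAtImInfty F :=
  isBoundedAtImInfty_of_hasSum_qExpansion (c := c) one_pos fun τ ↦ by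
    simpa only [qPow_eq_qParam, smul_eq_mul] using hF τ

lemma qExpansion_coeff_of_qSeries {c : ℕ → ℂ} {F : ℍ → ℂ}
    (hF : ∀ τ, HasSum (fun n ↦ c n * qPow n τ) (F τ)) (n : ℕ) :
    (qExpansion 1 F).coeff n = c n := by
  have ha := analyticAt_cuspFunction_zero one_pos (periodic_of_qSeries hF)
    (mdifferentiable_and_hasSum_normalizedDeriv_of_qSeries hF).1 (isBoundedAtImInfty_of_qSeries hF)
  have h1 := (hasFPowerSeriesOnBall_cuspFunction (c := c) one_pos ha fun τ ↦ by
    simpa only [qPow_eq_qParam, smul_eq_mul] using hF τ).hasFPowerSeriesAt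
  have h2 := congrArg (FormalMultilinearSeries.coeff · n)
    (h1.eq_formalMultilinearSeries ha.hasFPowerSeriesAt)
  rw [qExpansion_coeff]
  simpa [FormalMultilinearSeries.coeff_ofScalars, div_eq_mul_inv, mul_comm] using h2.symm

/-! ### A Bessel inequality -/

/-- Bessel's inequality, with the `L²` norm estimated by the supremum. -/
lemma sum_sq_le_of_fourier_bound {b : ℕ → ℂ} (hb : Summable fun n ↦ ‖b n‖) {A : ℝ}
    (hA : ∀ x : ℝ, ‖∑' n, b n * Complex.exp (2 * Real.pi * Complex.I * n * x)‖ ≤ A)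
    (s : Finset ℕ) : ∑ n ∈ s, ‖b n‖ ^ 2 ≤ A ^ 2 := by
  have : Fact ((0 : ℝ) < 1) := ⟨one_pos⟩
  have hA0 : 0 ≤ A := (norm_nonneg _).trans (hA 0)
  let F : C(AddCircle (1 : ℝ), ℂ) := ∑' n, b n • fourier (n : ℤ)
  have hsum : HasSum (fun n ↦ b n • (fourier (n : ℤ) : C(AddCircle (1 : ℝ), ℂ))) F := by
    refine Summable.hasSum (Summable.of_norm ?_)
    simpa [norm_smul, fourier_norm] using hb
  have hFA : ‖F‖ ≤ A := by
    rw [ContinuousMap.norm_le _ hA0]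
    intro x
    induction x using QuotientAddGroup.induction_on with | H x => ?_
    have h1 := (ContinuousMap.evalCLM ℂ (x : AddCircle (1 : ℝ))).hasSum hsum
    have h2 := h1.tsum_eq
    have h3 := hA x
    convert! h3 using 2
    rw [← ContinuousMap.evalCLM_apply ℂ, ← h2]
    refine tsum_congr fun n ↦ ?_
    have h4 : (fourier (n : ℤ) : C(AddCircle (1 : ℝ), ℂ)) (x : AddCircle (1 : ℝ)) =
        Complex.exp (2 * Real.pi * Complex.I * n * x) := by
      rw [fourier_coe_apply]
      simp
    rw [map_smul, ContinuousMap.evalCLM_apply, smul_eq_mul]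
    exact congrArg (b n * ·) h4
  let v : MeasureTheory.Lp ℂ 2 (@AddCircle.haarAddCircle 1 _) :=
    ContinuousMap.toLp (E := ℂ) 2 AddCircle.haarAddCircle ℂ F
  have hv : HasSum (fun n : ℕ ↦ b n • fourierLp (T := 1) 2 (n : ℤ)) v := by
    simpa [fourierLp] using (ContinuousMap.toLp (E := ℂ) 2 AddCircle.haarAddCircle ℂ).hasSum hsum
  have horth : Orthonormal ℂ fun n : ℕ ↦ fourierLp (T := 1) 2 (n : ℤ) :=
    orthonormal_fourier.comp _ Nat.cast_injective
  have hcoef (n : ℕ) : inner ℂ (fourierLp (T := 1) 2 (n : ℤ)) v = b n := by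
    have h1 := (innerSL ℂ (fourierLp (T := 1) 2 (n : ℤ))).hasSum hv
    refine h1.unique ?_
    convert! hasSum_ite_eq n (b n) using 2 with i
    rw [orthonormal_iff_ite] at horth
    simp only [map_smul, innerSL_apply_apply, horth n i, smul_eq_mul]
    rcases eq_or_ne i n with rfl | h
    · simp
    · simp [h, h.symm]
  have hvA : ‖v‖ ≤ A := by
    refine ((ContinuousMap.toLp (E := ℂ) 2 AddCircle.haarAddCircle ℂ).le_opNorm F).trans ?_
    have h1 := ContinuousMap.toLp_norm_le (E := ℂ) (p := 2) (𝕜 := ℂ)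
      (μ := @AddCircle.haarAddCircle 1 _)
    have h2 : MeasureTheory.measureUnivNNReal (@AddCircle.haarAddCircle 1 _) = 1 := by
      simp [MeasureTheory.measureUnivNNReal]
    rw [h2, NNReal.coe_one, Real.one_rpow] at h1
    calc _ ≤ 1 * ‖F‖ := by gcongr
      _ ≤ A := by simpa using hFA
  calc ∑ n ∈ s, ‖b n‖ ^ 2 = ∑ n ∈ s, ‖inner ℂ (fourierLp (T := 1) 2 (n : ℤ)) v‖ ^ 2 := by
        simp only [hcoef]
    _ ≤ ‖v‖ ^ 2 := horth.sum_inner_products_le v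
    _ ≤ A ^ 2 := by gcongr

/-! ### A reproducing kernel for the Poincaré series -/

lemma slash_natCast_apply (w : ℕ) (f : ℍ → ℂ) (M : SL(2, ℤ)) (τ : ℍ) :
    (f ∣[(w : ℤ)] M) τ = (denom M τ ^ w)⁻¹ * f (M • τ) := by
  rw [ModularForm.SL_slash_apply, zpow_neg, zpow_natCast, mul_comm]

lemma poincareSeries_apply (w n : ℕ) (τ : ℍ) : poincareSeries w n τ =
    ∑' c : Cosets, (denom c.out τ ^ w)⁻¹ * qPow n (c.out • τ) :=
  tsum_congr fun _ ↦ slash_natCast_apply _ _ _ _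

/-- The bilinear form `(c τ + d) z + (a τ + b)` attached to `M = (a b; c d)`. -/
def bilinForm (M : SL(2, ℤ)) (τ z : ℍ) : ℂ :=
  ((M 1 0 : ℂ) * τ + M 1 1) * z + ((M 0 0 : ℂ) * τ + M 0 1)

/-- The kernel `∑ ((c τ + d) z + (a τ + b)) ^ (-w)`, summed over all of `SL₂(ℤ)`. As a function of
`z` it is a cusp form whose `n`-th coefficient is a multiple of `n ^ (w - 1) P_{w,n}(τ)`. -/
def kernel (w : ℕ) (τ z : ℍ) : ℂ := ∑' M : SL(2, ℤ), (bilinForm M τ z ^ w)⁻¹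

lemma coe_smul_mul_denom (M : SL(2, ℤ)) (τ : ℍ) :
    ((M • τ : ℍ) : ℂ) * denom M τ = (M 0 0 : ℂ) * τ + M 0 1 := by
  have h := denom_ne_zero (M : GL (Fin 2) ℝ) τ
  rw [ModularGroup.denom_apply] at h ⊢
  rw [UpperHalfPlane.specialLinearGroup_apply]
  simp only [eq_intCast, Complex.ofReal_intCast]
  exact div_mul_cancel₀ _ h

/-- The kernel is invariant in `z`, because replacing `z` by `g z` permutes `SL₂(ℤ)`. -/
lemma kernel_slash (w : ℕ) (τ : ℍ) (g : SL(2, ℤ)) : kernel w τ ∣[(w : ℤ)] g = kernel w τ := by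
  ext z
  rw [slash_natCast_apply, kernel, kernel, ← tsum_mul_left]
  have hdet := g.det_coe
  rw [Matrix.det_fin_two] at hdet
  -- `h` satisfies `bilinForm (h * M) τ z = denom g z * bilinForm M τ (g • z)`
  obtain ⟨h, h00, h01, h10, h11⟩ : ∃ h : SL(2, ℤ),
      h 0 0 = g 1 1 ∧ h 0 1 = g 0 1 ∧ h 1 0 = g 1 0 ∧ h 1 1 = g 0 0 :=
    ⟨⟨!![g 1 1, g 0 1; g 1 0, g 0 0], by rw [Matrix.det_fin_two_of]; linarith⟩,
      rfl, rfl, rfl, rfl⟩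
  refine Eq.trans (tsum_congr fun M ↦ ?_)
    ((Equiv.mulLeft h).tsum_eq fun M ↦ (bilinForm M τ z ^ w)⁻¹)
  rw [← mul_inv, ← mul_pow]
  congr 2
  have h1 := coe_smul_mul_denom g z
  have h2 : denom g z = (g 1 0 : ℂ) * z + g 1 1 := rfl
  simp only [bilinForm, Equiv.coe_mulLeft, Matrix.SpecialLinearGroup.coe_mul, Matrix.mul_apply,
    Fin.sum_univ_two, h00, h01, h10, h11]
  push_cast
  linear_combination ((M 1 0 : ℂ) * τ + M 1 1) * h1 + ((M 0 0 : ℂ) * τ + M 0 1) * h2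

/-- Every element of `SL₂(ℤ)` is `± T ^ n` times a unique coset representative. -/
def cosetEquiv : Cosets × ℤ × Bool ≃ SL(2, ℤ) :=
  Equiv.ofBijective
    (fun x ↦ bif x.2.2 then -(ModularGroup.T ^ x.2.1 * x.1.out)
      else ModularGroup.T ^ x.2.1 * x.1.out)
    (by
      have hT (n : ℤ) : ModularGroup.T ^ n ∈ GammaInfty :=
        mem_GammaInfty_iff.mpr (by rw [ModularGroup.coe_T_zpow]; simp)
      have hT' (n : ℤ) : -ModularGroup.T ^ n ∈ GammaInfty :=
        mem_GammaInfty_iff.mpr (by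
          rw [Matrix.SpecialLinearGroup.coe_neg, ModularGroup.coe_T_zpow]; simp)
      constructor
      · rintro ⟨c, n, b⟩ ⟨c', n', b'⟩ h
        obtain ⟨g, hg, hgc⟩ : ∃ g, g ∈ GammaInfty ∧ (bif b then -(ModularGroup.T ^ n * c.out)
            else ModularGroup.T ^ n * c.out) = g * c.out := by
          cases b
          · exact ⟨_, hT n, rfl⟩
          · exact ⟨_, hT' n, by simp⟩
        obtain ⟨g', hg', hgc'⟩ : ∃ g, g ∈ GammaInfty ∧ (bif b' then -(ModularGroup.T ^ n' * c'.out)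
            else ModularGroup.T ^ n' * c'.out) = g * c'.out := by
          cases b'
          · exact ⟨_, hT n', rfl⟩
          · exact ⟨_, hT' n', by simp⟩
        have hcc : c = c' := by
          refine coset_eq_of_mul_inv_mem ?_
          have e : g * c.out = g' * c'.out := hgc.symm.trans (h.trans hgc')
          have : c'.out * c.out⁻¹ = g'⁻¹ * g := by
            rw [mul_inv_eq_iff_eq_mul, mul_assoc, e, inv_mul_cancel_left]
          rw [this]
          exact GammaInfty.mul_mem (GammaInfty.inv_mem hg') hg
        subst hcc
        cases b <;> cases b' <;>
          simp only [cond_false, cond_true, neg_inj, mul_left_inj, ← neg_mul] at h <;>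
          have h00 := congrArg (fun g : SL(2, ℤ) ↦ g 0 0) h <;>
          have h01 := congrArg (fun g : SL(2, ℤ) ↦ g 0 1) h <;>
          simp [ModularGroup.coe_T_zpow] at h00 h01
        · rw [h01]
        · rw [h01]
      · intro M
        let c : Cosets := Quotient.mk _ M
        have hrel : QuotientGroup.rightRel GammaInfty c.out M := Quotient.mk_out M
        rw [QuotientGroup.rightRel_apply, mem_GammaInfty_iff] at hrel
        obtain ⟨n, hn | hn⟩ := exists_eq_T_zpow_or hrel
        · exact ⟨⟨c, n, false⟩, by simp [← hn]⟩
        · exact ⟨⟨c, n, true⟩, by simp [← neg_mul, ← hn]⟩)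

lemma bilinForm_cosetEquiv_pow {w : ℕ} (hw : Even w) (τ z : ℍ) (c : Cosets) (n : ℤ) (b : Bool) :
    (bilinForm (cosetEquiv (c, n, b)) τ z ^ w)⁻¹ =
      (denom c.out τ ^ w)⁻¹ * 1 / (((z : ℂ) + (c.out • τ : ℍ)) + n) ^ w := by
  have h : bilinForm (ModularGroup.T ^ n * c.out) τ z =
      denom c.out τ * (((z : ℂ) + (c.out • τ : ℍ)) + n) := by
    have h1 := coe_smul_mul_denom c.out τ
    have h2 : denom c.out τ = (c.out 1 0 : ℂ) * τ + c.out 1 1 := rfl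
    simp only [bilinForm, Matrix.SpecialLinearGroup.coe_mul, ModularGroup.coe_T_zpow,
      Matrix.mul_apply, Fin.sum_univ_two]
    simp only [Matrix.of_apply, Matrix.cons_val', Matrix.cons_val_zero, Matrix.cons_val_one,
      Matrix.cons_val_fin_one]
    push_cast
    linear_combination (-1 : ℂ) * h1 - (n + z : ℂ) * h2
  have hneg (M : SL(2, ℤ)) : bilinForm (-M) τ z ^ w = bilinForm M τ z ^ w := by
    rw [← hw.neg_pow (bilinForm M τ z)]
    congr 1
    simp only [bilinForm, Matrix.SpecialLinearGroup.coe_neg, Matrix.neg_apply]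
    push_cast
    ring
  rw [mul_one, div_eq_mul_inv, ← mul_inv, ← mul_pow, ← h]
  cases b
  · rfl
  · exact congrArg _ (hneg _)

/-- The sums `∑ |z + n| ^ (-w)` over translates are bounded uniformly on `Im z ≥ y`. -/
lemma exists_bound_tsum_translates {w : ℕ} (hw : 3 ≤ w) {y : ℝ} (hy : 0 < y) :
    ∃ B, ∀ z : ℍ, y ≤ z.im → Summable (fun n : ℤ ↦ ‖1 / ((z : ℂ) + n) ^ w‖) ∧
      ∑' n : ℤ, ‖1 / ((z : ℂ) + n) ^ w‖ ≤ B := by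
  have hu : Summable fun n : ℤ ↦ (‖(![1, n] : Fin 2 → ℤ)‖ ^ w)⁻¹ := by
    have h := EisensteinSeries.summable_one_div_norm_rpow (k := w) (by exact_mod_cast hw)
    have hi : Function.Injective fun n : ℤ ↦ (![1, n] : Fin 2 → ℤ) := fun a b hab ↦ by
      simpa using congrFun hab 1
    refine (h.comp_injective hi).congr fun c ↦ ?_
    simp [Real.rpow_neg]
  let ρ := EisensteinSeries.r ⟨⟨1, y⟩, hy⟩
  have hρ : 0 < ρ := EisensteinSeries.r_pos _
  refine ⟨∑' n : ℤ, (ρ ^ w)⁻¹ * (‖(![1, n] : Fin 2 → ℤ)‖ ^ w)⁻¹, fun z hz ↦ ?_⟩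
  let z' : ℍ := ((-⌊z.re⌋ : ℤ) : ℝ) +ᵥ z
  have hz' : z' ∈ verticalStrip 1 y := by
    rw [mem_verticalStrip_iff]
    constructor
    · rw [abs_le]
      simp only [z', vadd_re]
      push_cast
      constructor <;> linarith [Int.floor_le z.re, Int.lt_floor_add_one z.re]
    · simpa [z'] using hz
  have hle (n : ℤ) : ‖1 / ((z' : ℂ) + n) ^ w‖ ≤ (ρ ^ w)⁻¹ * (‖(![1, n] : Fin 2 → ℤ)‖ ^ w)⁻¹ := by
    have hne : (![1, n] : Fin 2 → ℤ) ≠ 0 := fun h ↦ by simpa using congrFun h 0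
    have h1 := EisensteinSeries.r_mul_max_le z' hne
    have h2 := EisensteinSeries.r_lower_bound_on_verticalStrip z' hy hz'
    have h3 := one_le_norm_of_ne_zero hne
    rw [one_div, norm_inv, norm_pow, ← mul_inv, ← mul_pow]
    gcongr
    refine (mul_le_mul_of_nonneg_right h2 (norm_nonneg _)).trans ?_
    simpa using h1
  have hs : Summable fun n : ℤ ↦ ‖1 / ((z' : ℂ) + n) ^ w‖ :=
    (hu.mul_left _).of_nonneg_of_le (fun _ ↦ norm_nonneg _) hle
  have hshift : (fun n : ℤ ↦ ‖1 / ((z' : ℂ) + n) ^ w‖) =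
      (fun n : ℤ ↦ ‖1 / ((z : ℂ) + n) ^ w‖) ∘ Equiv.addRight (-⌊z.re⌋) := by
    ext n
    simp only [Function.comp_apply, Equiv.coe_addRight, z', coe_vadd]
    push_cast
    ring_nf
  rw [hshift, Equiv.summable_iff] at hs
  refine ⟨hs, ?_⟩
  rw [← (Equiv.addRight (-⌊z.re⌋)).tsum_eq fun n : ℤ ↦ ‖1 / ((z : ℂ) + n) ^ w‖]
  change ∑' n, ((fun n : ℤ ↦ ‖1 / ((z : ℂ) + n) ^ w‖) ∘ Equiv.addRight (-⌊z.re⌋)) n ≤ _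
  rw [← hshift]
  exact Summable.tsum_le_tsum hle (by rw [hshift, Equiv.summable_iff]; exact hs) (hu.mul_left _)

/-- The sum of two points of `ℍ`. -/
def addPoint (z z' : ℍ) : ℍ := ⟨z + z', by simpa using add_pos z.im_pos z'.im_pos⟩

lemma qPow_addPoint (n : ℕ) (z z' : ℍ) : qPow n (addPoint z z') = qPow n z * qPow n z' := by
  simp only [qPow, addPoint]
  rw [← mul_pow, ← Complex.exp_add, mul_add]

lemma tsum_prod_bool {𝕜 : Type*} [NormedField 𝕜] [CompleteSpace 𝕜] {g : ℤ → 𝕜}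
    (hg : Summable fun x : ℤ × Bool ↦ g x.1) : ∑' x : ℤ × Bool, g x.1 = 2 * ∑' n, g n := by
  rw [hg.tsum_prod, ← tsum_mul_left]
  simp [tsum_fintype, two_mul]

/-- The sum over `SL₂(ℤ)`, arranged by the cosets `Γ_∞ M`; the factor `2` comes from `± 1`. -/
lemma kernel_eq_tsum_cosets {w : ℕ} (hw : Even w) (hw3 : 3 ≤ w) (τ z : ℍ) :
    kernel w τ z = ∑' c : Cosets, 2 * ((denom c.out τ ^ w)⁻¹ *
      ∑' n : ℤ, 1 / ((addPoint z (c.out • τ) : ℂ) + n) ^ w) := by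
  obtain ⟨B, hB⟩ := exists_bound_tsum_translates hw3 z.im_pos
  have him (c : Cosets) : z.im ≤ (addPoint z (c.out • τ)).im := by
    have := (c.out • τ).im_pos
    change z.im ≤ ((z : ℂ) + (c.out • τ : ℍ)).im
    simp only [Complex.add_im, coe_im]
    linarith
  have hterm (x : Cosets × ℤ × Bool) : (bilinForm (cosetEquiv x) τ z ^ w)⁻¹ =
      (denom x.1.out τ ^ w)⁻¹ * (1 / ((addPoint z (x.1.out • τ) : ℂ) + x.2.1) ^ w) := by
    obtain ⟨c, n, b⟩ := x
    rw [bilinForm_cosetEquiv_pow hw, mul_div_assoc]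
    rfl
  have hfib (c : Cosets) : Summable fun x : ℤ × Bool ↦
      ‖(denom c.out τ ^ w)⁻¹ * (1 / ((addPoint z (c.out • τ) : ℂ) + x.1) ^ w)‖ := by
    rw [summable_prod_of_nonneg fun _ ↦ norm_nonneg _]
    refine ⟨fun _ ↦ (hasSum_fintype _).summable, ?_⟩
    simp only [tsum_fintype, Fintype.sum_bool, norm_mul]
    exact ((hB _ (him c)).1.mul_left _).add ((hB _ (him c)).1.mul_left _)
  have hsum : Summable fun x : Cosets × ℤ × Bool ↦
      (denom x.1.out τ ^ w)⁻¹ * (1 / ((addPoint z (x.1.out • τ) : ℂ) + x.2.1) ^ w) := by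
    refine Summable.of_norm ?_
    rw [summable_prod_of_nonneg fun _ ↦ norm_nonneg _]
    refine ⟨hfib, ?_⟩
    refine ((summable_norm_denom hw3 τ).mul_left (2 * B)).of_nonneg_of_le
      (fun c ↦ tsum_nonneg fun _ ↦ norm_nonneg _) fun c ↦ ?_
    rw [tsum_prod_bool (g := fun n ↦ ‖(denom c.out τ ^ w)⁻¹ *
      (1 / ((addPoint z (c.out • τ) : ℂ) + n) ^ w)‖) (hfib c)]
    simp only [norm_mul, tsum_mul_left]
    rw [norm_inv, norm_pow]
    have := (hB _ (him c)).2
    calc _ ≤ 2 * ((‖denom c.out τ‖ ^ w)⁻¹ * B) := by gcongr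
      _ = _ := by ring
  rw [kernel, ← cosetEquiv.tsum_eq]
  simp only [hterm]
  rw [hsum.tsum_prod]
  refine tsum_congr fun c ↦ ?_
  rw [tsum_prod_bool
    (g := fun n ↦ (denom c.out τ ^ w)⁻¹ * (1 / ((addPoint z (c.out • τ) : ℂ) + n) ^ w))
    (hfib c).of_norm, tsum_mul_left]

lemma summable_pow_mul_qPow (k : ℕ) (z : ℍ) :
    Summable fun n : ℕ ↦ ‖(n : ℂ) ^ k * qPow n z‖ :=
  summable_norm_pow_mul_geometric_of_norm_lt_one k (UpperHalfPlane.norm_exp_two_pi_I_lt_one z)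

/-- The Fourier expansion of the kernel, obtained from Lipschitz' formula for
`∑ (z + M τ + n) ^ (-w)`. -/
lemma exists_hasSum_kernel {w : ℕ} (hw : Even w) (hw3 : 3 ≤ w) (τ : ℍ) : ∃ κ : ℂ, κ ≠ 0 ∧
    ∀ z, HasSum (fun n : ℕ ↦ (κ * (n : ℂ) ^ (w - 1) * poincareSeries w n τ) * qPow n z)
      (kernel w τ z) := by
  obtain ⟨v, rfl⟩ : ∃ v, w = v + 1 := ⟨w - 1, by omega⟩
  refine ⟨2 * ((-2 * Real.pi * Complex.I) ^ (v + 1) / v.factorial), ?_, fun z ↦ ?_⟩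
  · have := Real.pi_ne_zero
    have := v.factorial_ne_zero
    simp [*]
  set κ : ℂ := 2 * ((-2 * Real.pi * Complex.I) ^ (v + 1) / v.factorial)
  have hs : Summable fun x : Cosets × ℕ ↦ (denom x.1.out τ ^ (v + 1))⁻¹ *
      (κ * (((x.2 : ℂ) ^ v * qPow x.2 z) * qPow x.2 (x.1.out • τ))) := by
    refine Summable.of_norm_bounded (g := fun x : Cosets × ℕ ↦ (‖denom x.1.out τ‖ ^ (v + 1))⁻¹ *
      (‖κ‖ * ‖(x.2 : ℂ) ^ v * qPow x.2 z‖)) (((summable_norm_denom hw3 τ).mul_of_nonneg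
      ((summable_pow_mul_qPow v z).mul_left ‖κ‖) (fun _ ↦ by positivity)
      (fun _ ↦ by positivity))) fun x ↦ ?_
    rw [norm_mul, norm_mul κ, norm_mul (_ * _), norm_inv, norm_pow]
    have := mul_le_of_le_one_right (norm_nonneg ((x.2 : ℂ) ^ v * qPow x.2 z))
      (norm_qPow_le_one x.2 (x.1.out • τ))
    gcongr
  have h1 : kernel (v + 1) τ z = ∑' x : Cosets × ℕ, (denom x.1.out τ ^ (v + 1))⁻¹ *
      (κ * (((x.2 : ℂ) ^ v * qPow x.2 z) * qPow x.2 (x.1.out • τ))) := by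
    rw [kernel_eq_tsum_cosets hw hw3, hs.tsum_prod]
    refine tsum_congr fun c ↦ ?_
    rw [EisensteinSeries.qExpansion_identity (by omega)]
    simp only [tsum_mul_left]
    have h2 (n : ℕ) : (n : ℂ) ^ v * qPow n z * qPow n (c.out • τ) = (n : ℂ) ^ v *
        Complex.exp (2 * Real.pi * Complex.I * (addPoint z (c.out • τ) : ℍ)) ^ n := by
      rw [mul_assoc, ← qPow_addPoint]
      rfl
    simp only [h2, κ]
    ring
  have h3 := (hs.prod_symm.hasSum).prod_fiberwise fun n ↦ (hs.prod_symm.prod_factor n).hasSum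
  rw [h1, ← (Equiv.prodComm ℕ Cosets).tsum_eq]
  convert! h3 using 2 with n
  rw [poincareSeries_apply, Nat.add_sub_cancel, mul_right_comm, ← tsum_mul_left]
  refine tsum_congr fun c ↦ ?_
  simp only [Prod.swap]
  ring

/-! ### Poincaré series in the mean over `n` -/

/-- A function given by a power series in `q` and invariant under the slash action of `SL₂(ℤ)` is
a modular form of level one. -/
def modularFormOfQSeries {w : ℤ} {c : ℕ → ℂ} {F : ℍ → ℂ}
    (hF : ∀ τ, HasSum (fun n ↦ c n * qPow n τ) (F τ)) (hw : ∀ g : SL(2, ℤ), F ∣[w] g = F) :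
    ModularForm 𝒮ℒ w where
  toFun := F
  slash_action_eq' := fun _ ⟨g, hg⟩ ↦ hg ▸ hw g
  holo' := (mdifferentiable_and_hasSum_normalizedDeriv_of_qSeries hF).1
  bdd_at_cusps' {x} hx := by
    rw [Subgroup.IsArithmetic.isCusp_iff_isCusp_SL2Z] at hx
    rw [OnePoint.isBoundedAt_iff_forall_SL2Z hx]
    intro γ _
    rw [hw γ]
    exact isBoundedAtImInfty_of_qSeries hF

/-- Hecke's bound for a cusp form that is given by its `q`-series. -/
lemma exists_bound_of_qSeries {w : ℤ} {c : ℕ → ℂ} {F : ℍ → ℂ}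
    (hF : ∀ τ, HasSum (fun n ↦ c n * qPow n τ) (F τ)) (hw : ∀ g : SL(2, ℤ), F ∣[w] g = F)
    (h0 : c 0 = 0) : ∃ C, ∀ z : ℍ, ‖F z‖ ≤ C / z.im ^ (w / 2 : ℝ) :=
  CuspFormClass.exists_bound (ModularForm.toCuspForm (modularFormOfQSeries hF hw)
    ((qExpansion_coeff_of_qSeries hF 0).trans h0))

/-- Bessel's inequality on the horizontal line `Im τ = y`. -/
lemma sum_sq_coeff_le {c : ℕ → ℂ} {F : ℍ → ℂ}
    (hF : ∀ τ, HasSum (fun n ↦ c n * qPow n τ) (F τ)) {y A : ℝ} (hy : 0 < y)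
    (hA : ∀ τ : ℍ, τ.im = y → ‖F τ‖ ≤ A) (s : Finset ℕ) :
    ∑ n ∈ s, (‖c n‖ * Real.exp (-(2 * Real.pi * y)) ^ n) ^ 2 ≤ A ^ 2 := by
  let τ₀ : ℍ := ⟨⟨0, y⟩, hy⟩
  have h0 (n : ℕ) : ‖c n * qPow n τ₀‖ = ‖c n‖ * Real.exp (-(2 * Real.pi * y)) ^ n := by
    rw [norm_mul, norm_qPow]
    rfl
  simp only [← h0]
  refine sum_sq_le_of_fourier_bound (hF τ₀).summable.norm (fun x ↦ ?_) s
  have hx (n : ℕ) : c n * qPow n τ₀ * Complex.exp (2 * Real.pi * Complex.I * n * x) =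
      c n * qPow n (x +ᵥ τ₀) := by
    have : (2 * Real.pi * Complex.I * n * x : ℂ) = n * (2 * Real.pi * Complex.I * x) := by ring
    simp only [qPow]
    rw [mul_assoc, this, Complex.exp_nat_mul, ← mul_pow, ← Complex.exp_add, coe_vadd]
    ring_nf
  simp only [hx, (hF _).tsum_eq]
  exact hA _ (by simp [τ₀])

/-- If `∑ (a n e ^ (-2 π n y)) ^ 2` is `O (y ^ (-2 v))` for all `y > 0`, then `a n` is
`O (n ^ (v - 1 / 2))` on average, which makes `∑ a n / n ^ (v + 1)` convergent. -/
lemma summable_div_pow_of_sum_sq_le {a : ℕ → ℝ} (ha : ∀ n, 0 ≤ a n) {v : ℕ} {C : ℝ}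
    (h : ∀ y : ℝ, 0 < y → ∀ s : Finset ℕ,
      ∑ n ∈ s, (a n * Real.exp (-(2 * Real.pi * y)) ^ n) ^ 2 ≤ (C / y ^ v) ^ 2) :
    Summable fun n : ℕ ↦ a n / (n : ℝ) ^ (v + 1) := by
  -- the block `2 ^ j ≤ n < 2 ^ (j + 1)` is estimated with `y = 2 ^ (-j)`
  have hblock (j : ℕ) (s : Finset ℕ) (hs : ∀ n ∈ s, 2 ^ j ≤ n ∧ n < 2 ^ (j + 1)) :
      ∑ n ∈ s, a n ^ 2 / ((n : ℝ) ^ (2 * v) * √n) ≤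
        Real.exp (8 * Real.pi) * C ^ 2 * (√2)⁻¹ ^ j := by
    have hy : (0 : ℝ) < (2 ^ j)⁻¹ := by positivity
    have h2 : (0 : ℝ) < 2 ^ j := by positivity
    have hterm (n : ℕ) (hn : n ∈ s) : a n ^ 2 / ((n : ℝ) ^ (2 * v) * √n) ≤
        Real.exp (8 * Real.pi) * (((2 : ℝ) ^ j) ^ (2 * v) * √2 ^ j)⁻¹ *
          (a n * Real.exp (-(2 * Real.pi * (2 ^ j)⁻¹)) ^ n) ^ 2 := by
      obtain ⟨h3, h4⟩ := hs n hn
      have h3' : (2 : ℝ) ^ j ≤ n := by exact_mod_cast h3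
      have h4' : (n : ℝ) < 2 ^ (j + 1) := by exact_mod_cast h4
      have h5 : √2 ^ j ≤ √n := by
        refine Real.le_sqrt_of_sq_le ?_
        rwa [← pow_mul, mul_comm j, pow_mul, Real.sq_sqrt (by norm_num)]
      have h6 : 1 ≤ Real.exp (8 * Real.pi) * (Real.exp (-(2 * Real.pi * (2 ^ j)⁻¹)) ^ n) ^ 2 := by
        rw [← pow_mul, ← Real.exp_nat_mul, ← Real.exp_add, Real.one_le_exp_iff]
        have h7 : (n : ℝ) * (2 ^ j)⁻¹ ≤ 2 := by
          rw [← div_eq_mul_inv, div_le_iff₀ h2, ← pow_succ']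
          exact h4'.le
        push_cast
        nlinarith [Real.pi_pos]
      calc a n ^ 2 / ((n : ℝ) ^ (2 * v) * √n)
          ≤ a n ^ 2 / (((2 : ℝ) ^ j) ^ (2 * v) * √2 ^ j) := by gcongr
        _ = a n ^ 2 * (((2 : ℝ) ^ j) ^ (2 * v) * √2 ^ j)⁻¹ * 1 := by rw [mul_one, div_eq_mul_inv]
        _ ≤ a n ^ 2 * (((2 : ℝ) ^ j) ^ (2 * v) * √2 ^ j)⁻¹ *
            (Real.exp (8 * Real.pi) * (Real.exp (-(2 * Real.pi * (2 ^ j)⁻¹)) ^ n) ^ 2) := by gcongr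
        _ = _ := by ring
    refine (sum_le_sum hterm).trans ?_
    rw [← mul_sum]
    calc _ ≤ Real.exp (8 * Real.pi) * (((2 : ℝ) ^ j) ^ (2 * v) * √2 ^ j)⁻¹ *
          (C / ((2 ^ j)⁻¹) ^ v) ^ 2 := by gcongr; exact h _ hy s
      _ = _ := by
        rw [inv_pow, inv_pow]
        field_simp
        ring
  have hT : Summable fun n : ℕ ↦ a n ^ 2 / ((n : ℝ) ^ (2 * v) * √n) := by
    have hgeo : Summable fun j : ℕ ↦ Real.exp (8 * Real.pi) * C ^ 2 * (√2)⁻¹ ^ j := by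
      refine (summable_geometric_of_lt_one (by positivity) (inv_lt_one_of_one_lt₀ ?_)).mul_left _
      rw [Real.lt_sqrt] <;> norm_num
    refine summable_of_sum_le (c := ∑' j : ℕ, Real.exp (8 * Real.pi) * C ^ 2 * (√2)⁻¹ ^ j)
      (fun n ↦ by positivity) fun s ↦ ?_
    -- the term `n = 0` vanishes, because of the junk value `x / 0 = 0`
    have h0 : ∑ n ∈ s, a n ^ 2 / ((n : ℝ) ^ (2 * v) * √n) =
        ∑ n ∈ s with n ≠ 0, a n ^ 2 / ((n : ℝ) ^ (2 * v) * √n) := by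
      rw [sum_filter]
      refine sum_congr rfl fun n _ ↦ ?_
      split_ifs with hn
      · rfl
      · simp [not_not.mp hn]
    let t : Finset ℕ := (s.filter (· ≠ 0)).image (Nat.log 2)
    rw [h0, ← sum_fiberwise_of_maps_to (t := t) (g := Nat.log 2)
      fun n hn ↦ mem_image_of_mem _ hn]
    refine (sum_le_sum fun j _ ↦ hblock j _ fun n hn ↦ ?_).trans
      (hgeo.sum_le_tsum t fun j _ ↦ by positivity)
    simp only [mem_filter] at hn
    obtain ⟨⟨-, hn0⟩, rfl⟩ := hn
    exact ⟨Nat.pow_log_le_self 2 hn0, Nat.lt_pow_succ_log_self (by norm_num) n⟩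
  have h32 : Summable fun n : ℕ ↦ √n / (n : ℝ) ^ 2 := by
    refine (Real.summable_nat_rpow_inv.mpr (by norm_num : (1 : ℝ) < 3 / 2)).congr fun n ↦ ?_
    rcases n.eq_zero_or_pos with rfl | hn
    · simp
    · have hn' : (0 : ℝ) < n := by exact_mod_cast hn
      rw [Real.sqrt_eq_rpow, ← Real.rpow_natCast, ← Real.rpow_sub hn', ← Real.rpow_neg hn'.le]
      norm_num
  -- `a n / n ^ (v + 1)` is bounded by the sum of both terms, because `x y ≤ x ^ 2 + y ^ 2`
  refine (hT.add h32).of_nonneg_of_le (fun n ↦ div_nonneg (ha n) (by positivity)) fun n ↦ ?_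
  rcases n.eq_zero_or_pos with rfl | hn
  · simp
  · have hn' : (0 : ℝ) < n := by exact_mod_cast hn
    have hs : 0 < √(n : ℝ) := Real.sqrt_pos.mpr hn'
    set x := a n / (n : ℝ) ^ v with hx
    have hx0 : 0 ≤ x := div_nonneg (ha n) (by positivity)
    have e1 : a n / (n : ℝ) ^ (v + 1) = x / n := by rw [hx, pow_succ, div_div]
    have e2 : a n ^ 2 / ((n : ℝ) ^ (2 * v) * √n) = x ^ 2 / √n := by
      rw [hx, div_pow, div_div, ← pow_mul, mul_comm v]
    rw [e1, e2]
    have h1 : x / n * √n ≤ x ^ 2 + (√n / n) ^ 2 := by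
      have e3 : x / n * √n = x * (√n / n) := by ring
      rw [e3]
      nlinarith [sq_nonneg (x - √n / n), mul_nonneg hx0 (by positivity : 0 ≤ √(n : ℝ) / n)]
    calc x / n = x / n * √n / √n := by field_simp
      _ ≤ (x ^ 2 + (√n / n) ^ 2) / √n := by gcongr
      _ = x ^ 2 / √n + √n / (n : ℝ) ^ 2 := by field_simp

/-- For fixed `τ` the values `P_{2v,n}(τ)` are `O (n ^ (1 / 2 - v))` on average, since
`n ^ (2 v - 1) P_{2v,n}(τ)` are, up to a constant factor, the Fourier coefficients of a cusp form
of weight `2 v`. -/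
theorem summable_pow_mul_norm_poincareSeries {v : ℕ} (hv : 2 ≤ v) (τ : ℍ) :
    Summable fun n : ℕ ↦ (n : ℝ) ^ (v - 2) * ‖poincareSeries (2 * v : ℕ) n τ‖ := by
  obtain ⟨κ, hκ, hK⟩ := exists_hasSum_kernel (even_two_mul v) (by omega) τ
  obtain ⟨C, hC⟩ := exists_bound_of_qSeries hK (kernel_slash (2 * v) τ)
    (by simp [show 2 * v - 1 ≠ 0 by omega])
  have hs := summable_div_pow_of_sum_sq_le (C := C) (v := v) (fun n ↦ norm_nonneg _)
    fun y hy s ↦ sum_sq_coeff_le hK hy (fun z hz ↦ by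
      have := hC z
      rw [hz] at this
      convert! this using 2
      rw [← Real.rpow_natCast]
      push_cast
      ring_nf) s
  rw [← summable_nat_add_iff 1] at hs ⊢
  refine (hs.mul_left ‖κ‖⁻¹).congr fun n ↦ ?_
  have hκ' : ‖κ‖ ≠ 0 := norm_ne_zero_iff.mpr hκ
  have hn : ((n + 1 : ℕ) : ℝ) ≠ 0 := by positivity
  obtain ⟨u, rfl⟩ : ∃ u, v = u + 2 := ⟨v - 2, by omega⟩
  rw [norm_mul, norm_mul, norm_pow, Complex.norm_natCast,
    show 2 * (u + 2) - 1 = u + (u + 2 + 1) by omega, pow_add _ u, Nat.add_sub_cancel]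
  field_simp

/-! ### Abel summation -/

/-- The `q`-series, translated vertically by `ε`, gains exponential decay, so that the two
summations may be interchanged. -/
lemma tsum_mul_poincareSeries_mul_qPow {w : ℕ} (hw : 3 ≤ w) {c : ℕ → ℂ} {φ : ℍ → ℂ}
    (hφ : ∀ τ, HasSum (fun n ↦ c n * qPow n τ) (φ τ)) (τ ε : ℍ) :
    ∑' n, c n * poincareSeries w n τ * qPow n ε =
      ∑' x : Cosets, (denom x.out τ ^ w)⁻¹ * φ (addPoint (x.out • τ) ε) := by
  have hprod : Summable fun p : Cosets × ℕ ↦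
      (‖denom p.1.out τ‖ ^ w)⁻¹ * ‖c p.2 * qPow p.2 ε‖ :=
    (summable_norm_denom hw τ).mul_of_nonneg (hφ ε).summable.norm
      (fun _ ↦ inv_nonneg.mpr (pow_nonneg (norm_nonneg _) _)) (fun _ ↦ norm_nonneg _)
  have hsum : Summable fun p : Cosets × ℕ ↦ (denom p.1.out τ ^ w)⁻¹ *
      ((c p.2 * qPow p.2 ε) * qPow p.2 (p.1.out • τ)) := by
    refine Summable.of_norm_bounded hprod fun p ↦ ?_
    rw [norm_mul, norm_mul (c p.2 * qPow p.2 ε), norm_inv, norm_pow]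
    exact mul_le_mul_of_nonneg_left
      (mul_le_of_le_one_right (norm_nonneg _) (norm_qPow_le_one p.2 (p.1.out • τ)))
      (inv_nonneg.mpr (pow_nonneg (norm_nonneg _) _))
  have hterm (n : ℕ) : c n * poincareSeries w n τ * qPow n ε = ∑' x : Cosets,
      (denom x.out τ ^ w)⁻¹ * ((c n * qPow n ε) * qPow n (x.out • τ)) := by
    rw [poincareSeries_apply, mul_right_comm, ← tsum_mul_left]
    exact tsum_congr fun x ↦ mul_left_comm _ _ _
  have hrow (x : Cosets) : ∑' n, (denom x.out τ ^ w)⁻¹ *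
      ((c n * qPow n ε) * qPow n (x.out • τ)) =
      (denom x.out τ ^ w)⁻¹ * φ (addPoint (x.out • τ) ε) := by
    rw [tsum_mul_left, ← (hφ _).tsum_eq]
    congr 1
    refine tsum_congr fun n ↦ ?_
    rw [qPow_addPoint, mul_assoc, mul_comm (qPow n ε)]
  rw [tsum_congr hterm, ← tsum_congr hrow]
  exact Summable.tsum_comm hsum

/-- Two ways of summing `c n (q ^ n ∣ M)` over `n` and `M` agree, if both converge absolutely in the
sense of `hs` and `hφu`: the shift by `i / (j + 1)` makes the double series absolutely convergent,
and the limit `j → ∞` is taken on both sides by dominated convergence. -/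
lemma hasSum_mul_poincareSeries_of_dominated {w : ℕ} (hw : 3 ≤ w) {c : ℕ → ℂ} {φ : ℍ → ℂ}
    (hφ : ∀ τ, HasSum (fun n ↦ c n * qPow n τ) (φ τ)) (τ : ℍ)
    (hs : Summable fun n ↦ ‖c n * poincareSeries w n τ‖) {u : Cosets → ℝ} (hu : Summable u)
    (hφu : ∀ x : Cosets, ∀ ε : ℍ, ε.re = 0 →
      ‖(denom x.out τ ^ w)⁻¹ * φ (addPoint (x.out • τ) ε)‖ ≤ u x) :
    HasSum (fun n ↦ c n * poincareSeries w n τ) (poincareAverage w φ τ) := by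
  let ε (j : ℕ) : ℍ := ⟨⟨0, ((j : ℝ) + 1)⁻¹⟩, by positivity⟩
  have hε (j : ℕ) : (ε j).re = 0 := rfl
  have hε0 : Filter.Tendsto (fun j ↦ (ε j : ℂ)) Filter.atTop (nhds 0) := by
    have h1 : Filter.Tendsto (fun j : ℕ ↦ (((j : ℝ) + 1)⁻¹ : ℝ)) Filter.atTop (nhds 0) := by
      simpa using tendsto_one_div_add_atTop_nhds_zero_nat (𝕜 := ℝ)
    have h2 : (fun j ↦ (ε j : ℂ)) = fun j : ℕ ↦ ((((j : ℝ) + 1)⁻¹ : ℝ) : ℂ) * Complex.I := by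
      ext j
      change (⟨0, _⟩ : ℂ) = _
      rw [Complex.mk_eq_add_mul_I, Complex.ofReal_zero, zero_add]
    rw [h2]
    simpa using ((Complex.continuous_ofReal.tendsto 0).comp h1).mul_const Complex.I
  have hleft : Filter.Tendsto (fun j ↦ ∑' n, c n * poincareSeries w n τ * qPow n (ε j))
      Filter.atTop (nhds (∑' n, c n * poincareSeries w n τ)) := by
    refine tendsto_tsum_of_dominated_convergence hs (fun n ↦ ?_) (.of_forall fun j n ↦ ?_)
    · have hc : Continuous fun z : ℂ ↦ Complex.exp (2 * Real.pi * Complex.I * z) ^ n := by fun_prop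
      have h1 := ((hc.tendsto 0).comp hε0).const_mul (c n * poincareSeries w n τ)
      simpa [qPow] using h1
    · rw [norm_mul _ (qPow n (ε j))]
      exact mul_le_of_le_one_right (norm_nonneg _) (norm_qPow_le_one _ _)
  have hright : Filter.Tendsto
      (fun j ↦ ∑' x : Cosets, (denom x.out τ ^ w)⁻¹ * φ (addPoint (x.out • τ) (ε j)))
      Filter.atTop (nhds (poincareAverage w φ τ)) := by
    have hcont : Continuous φ :=
      (mdifferentiable_and_hasSum_normalizedDeriv_of_qSeries hφ).1.continuous
    have hP : poincareAverage w φ τ = ∑' x : Cosets, (denom x.out τ ^ w)⁻¹ * φ (x.out • τ) :=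
      tsum_congr fun x ↦ slash_natCast_apply _ _ _ _
    rw [hP]
    refine tendsto_tsum_of_dominated_convergence hu (fun x ↦ ?_)
      (.of_forall fun j x ↦ hφu x _ (hε j))
    refine Filter.Tendsto.const_mul _ ((hcont.tendsto _).comp ?_)
    rw [isEmbedding_coe.tendsto_nhds_iff]
    simpa [Function.comp_def, addPoint] using hε0.const_add ((x.out • τ : ℍ) : ℂ)
  simp only [tsum_mul_poincareSeries_mul_qPow hw hφ] at hleft
  rw [← tendsto_nhds_unique hleft hright]
  exact hs.of_norm.hasSum

/-! ### Growth of the derivatives of a modular form along vertical lines -/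

/-- `F` is bounded at `z` by a multiple of `(Im z) ^ (-r) ρ ^ (-k)`, whenever `ρ > 0` is a lower
bound for all `|c z + d|` with integers `(c, d) ≠ (0, 0)`. Modular forms of weight `k` satisfy this
with `r = 0`; in contrast to bounds in terms of `Im z` alone, it survives moving `M τ` vertically
upwards without loss. -/
def LatticeBound (k r : ℕ) (F : ℍ → ℂ) : Prop :=
  ∃ C : ℝ, 0 ≤ C ∧ ∀ (z : ℍ) (ρ : ℝ), 0 < ρ →
    (∀ v : Fin 2 → ℤ, v ≠ 0 → ρ ≤ ‖(v 0 : ℂ) * z + v 1‖) → ‖F z‖ ≤ C * (z.im ^ r * ρ ^ k)⁻¹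

/-- Moving `z` to the fundamental domain by some `g` shows that `f z` is bounded by a multiple of
`|c z + d| ^ (-k)`, where `(c, d)` is the bottom row of `g`. -/
lemma latticeBound_of_slash_eq {k : ℕ} {f : ℍ → ℂ} (hf : Continuous f)
    (hb : IsBoundedAtImInfty f) (hk : ∀ M : SL(2, ℤ), f ∣[(k : ℤ)] M = f) :
    LatticeBound k 0 f := by
  obtain ⟨C, hC⟩ := ModularGroup.exists_bound_fundamental_domain_of_isBigO (t := 0) hf
    (by simpa only [Real.rpow_zero] using! hb)
  simp only [Real.rpow_zero, mul_one] at hC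
  refine ⟨max C 0, le_max_right _ _, fun z ρ hρ h ↦ ?_⟩
  obtain ⟨g, hg⟩ := ModularGroup.exists_smul_mem_fd z
  have h1 : f z = (denom g z ^ k)⁻¹ * f (g • z) := by
    rw [← slash_natCast_apply, hk]
  have h2 : ρ ≤ ‖denom g z‖ := h _ (row_ne_zero g)
  rw [h1, norm_mul, norm_inv, norm_pow, pow_zero, one_mul, mul_comm]
  gcongr
  exact (hC _ hg).trans (le_max_left _ _)

/-- Cauchy's estimate on the disc of radius `Im z / 2` about `z`: within this disc `|c z + d|`
decreases at most by the factor `2`. -/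
lemma LatticeBound.normalizedDeriv {k r : ℕ} {F : ℍ → ℂ} (hF : LatticeBound k r F)
    (hd : MDiff F) : LatticeBound k (r + 1) (D F) := by
  obtain ⟨C, hC0, hC⟩ := hF
  refine ⟨C * 2 ^ (r + 1 + k), by positivity, fun z ρ hρ h ↦ ?_⟩
  have hz := z.im_pos
  have hR : 0 < z.im / 2 := by positivity
  have him (w : ℂ) (hw : w ∈ Metric.closedBall (z : ℂ) (z.im / 2)) : z.im / 2 ≤ w.im := by
    have h1 := (Complex.abs_im_le_norm (w - z)).trans (mem_closedBall_iff_norm.mp hw)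
    have h2 := (abs_le.mp h1).1
    simp only [Complex.sub_im, coe_im] at h2
    linarith
  have hsub : Metric.closedBall (z : ℂ) (z.im / 2) ⊆ upperHalfPlaneSet :=
    fun w hw ↦ hR.trans_le (him w hw)
  have hdiff : DiffContOnCl ℂ (F ∘ ofComplex) (Metric.ball (z : ℂ) (z.im / 2)) := by
    refine DifferentiableOn.diffContOnCl ?_
    rw [closure_ball _ hR.ne']
    exact (UpperHalfPlane.mdifferentiable_iff.mp hd).mono hsub
  have hbound : ∀ w ∈ Metric.sphere (z : ℂ) (z.im / 2),
      ‖(F ∘ ofComplex) w‖ ≤ C * ((z.im / 2) ^ r * (ρ / 2) ^ k)⁻¹ := by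
    intro w hw
    have hwc := Metric.sphere_subset_closedBall hw
    have hw0 : 0 < w.im := hsub hwc
    have hlow : ∀ v : Fin 2 → ℤ, v ≠ 0 → ρ / 2 ≤ ‖(v 0 : ℂ) * (⟨w, hw0⟩ : ℍ) + v 1‖ := by
      intro v hv
      have h1 := h v hv
      have h2 : |(v 0 : ℝ)| * z.im ≤ ‖(v 0 : ℂ) * z + v 1‖ := by
        have := Complex.abs_im_le_norm ((v 0 : ℂ) * z + v 1)
        simpa [abs_mul, abs_of_pos hz] using this
      have h3 : ‖(v 0 : ℂ) * (z - w)‖ = |(v 0 : ℝ)| * (z.im / 2) := by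
        rw [norm_mul, norm_sub_rev, mem_sphere_iff_norm.mp hw, Complex.norm_intCast]
      have h4 : (v 0 : ℂ) * z + v 1 = ((v 0 : ℂ) * w + v 1) + (v 0 : ℂ) * (z - w) := by ring
      have h5 := norm_add_le ((v 0 : ℂ) * w + v 1) ((v 0 : ℂ) * (z - w))
      rw [← h4, h3] at h5
      change ρ / 2 ≤ ‖(v 0 : ℂ) * w + v 1‖
      linarith
    rw [Function.comp_apply, ofComplex_apply_of_im_pos hw0]
    refine (hC ⟨w, hw0⟩ (ρ / 2) (by positivity) hlow).trans ?_
    have := him w hwc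
    gcongr
    exact this
  have hder := Complex.norm_deriv_le_of_forall_mem_sphere_norm_le hR hdiff hbound
  have hpi : ‖(2 * Real.pi * Complex.I : ℂ)⁻¹‖ ≤ 1 := by
    rw [norm_inv]
    refine inv_le_one_of_one_le₀ ?_
    simp only [norm_mul, Complex.norm_ofNat, Complex.norm_real, Complex.norm_I, mul_one,
      Real.norm_of_nonneg Real.pi_pos.le]
    linarith [Real.pi_gt_three]
  calc ‖D F z‖ = ‖(2 * Real.pi * Complex.I : ℂ)⁻¹‖ * ‖deriv (F ∘ ofComplex) z‖ := norm_mul _ _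
    _ ≤ 1 * (C * ((z.im / 2) ^ r * (ρ / 2) ^ k)⁻¹ / (z.im / 2)) := by gcongr
    _ = C * 2 ^ (r + 1 + k) * (z.im ^ (r + 1) * ρ ^ k)⁻¹ := by
      rw [div_pow, div_pow, pow_add, pow_succ, pow_succ]
      field_simp

lemma LatticeBound.iterD {k : ℕ} {f : ℍ → ℂ} (hf : LatticeBound k 0 f) (hd : MDiff f) (r : ℕ) :
    LatticeBound k r (iterD r f) := by
  induction r with
  | zero => exact hf
  | succ r ih =>
    rw [iterD_succ]
    exact ih.normalizedDeriv (mdifferentiable_iterD hd r)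

/-- The lattice points `|c z + d|` at `z = M τ + i ε` are bounded below in terms of `M` only. -/
lemma le_norm_lattice_addPoint (M : SL(2, ℤ)) (τ ε : ℍ) (hε : ε.re = 0) {v : Fin 2 → ℤ}
    (hv : v ≠ 0) : EisensteinSeries.r τ / ‖denom M τ‖ ≤
      ‖(v 0 : ℂ) * (addPoint (M • τ) ε : ℍ) + v 1‖ := by
  let v' : Fin 2 → ℤ := ![v 0 * M 0 0 + v 1 * M 1 0, v 0 * M 0 1 + v 1 * M 1 1]
  have hv' : v' ≠ 0 := by
    intro h
    have h0 : v 0 * M 0 0 + v 1 * M 1 0 = 0 := congrFun h 0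
    have h1 : v 0 * M 0 1 + v 1 * M 1 1 = 0 := congrFun h 1
    have hdet := M.det_coe
    rw [Matrix.det_fin_two] at hdet
    refine hv (funext fun i ↦ ?_)
    fin_cases i
    · change v 0 = 0
      linear_combination M 1 1 * h0 - M 1 0 * h1 - v 0 * hdet
    · change v 1 = 0
      linear_combination M 0 0 * h1 - M 0 1 * h0 - v 1 * hdet
  have h1 : EisensteinSeries.r τ ≤ ‖(v' 0 : ℂ) * τ + v' 1‖ :=
    (le_mul_of_one_le_right (EisensteinSeries.r_pos τ).le (one_le_norm_of_ne_zero hv')).trans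
      (EisensteinSeries.r_mul_max_le τ hv')
  have h2 : (v' 0 : ℂ) * τ + v' 1 = ((v 0 : ℂ) * (M • τ : ℍ) + v 1) * denom M τ := by
    have e1 := coe_smul_mul_denom M τ
    have e2 : denom M τ = (M 1 0 : ℂ) * τ + M 1 1 := rfl
    simp only [v', Matrix.cons_val_zero, Matrix.cons_val_one, Matrix.cons_val_fin_one]
    push_cast
    linear_combination (-(v 0 : ℂ)) * e1 - (v 1 : ℂ) * e2
  rw [h2, norm_mul] at h1
  rw [div_le_iff₀ (norm_denom_pos M τ)]
  refine h1.trans (mul_le_mul_of_nonneg_right ?_ (norm_nonneg _))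
  rw [← sq_le_sq₀ (norm_nonneg _) (norm_nonneg _), ← Complex.normSq_eq_norm_sq,
    ← Complex.normSq_eq_norm_sq, Complex.normSq_apply, Complex.normSq_apply]
  have hre : (ε : ℂ).re = 0 := hε
  have hp : 0 < (ε : ℂ).im := ε.im_pos
  have hp' : 0 < ((M • τ : ℍ) : ℂ).im := (M • τ).im_pos
  simp only [addPoint, Complex.add_re, Complex.mul_re, Complex.intCast_re, Complex.intCast_im,
    Complex.add_im, Complex.mul_im, hre]
  have h3 : ((v 0 : ℝ) * ((M • τ : ℍ) : ℂ).im) ^ 2 ≤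
      ((v 0 : ℝ) * (((M • τ : ℍ) : ℂ).im + (ε : ℂ).im)) ^ 2 := by
    rw [mul_pow, mul_pow]
    gcongr
    linarith
  nlinarith [h3]

/-- The bound that makes the Abel summation work: the terms of the series over cosets, translated
vertically, are dominated by `|c τ + d| ^ (-l)`. -/
lemma LatticeBound.exists_bound_addPoint {k r : ℕ} {F : ℍ → ℂ} (hF : LatticeBound k r F)
    (τ : ℍ) (l : ℕ) {m : ℕ} (hr : r ≤ m) : ∃ C, ∀ (M : SL(2, ℤ)) (ε : ℍ), ε.re = 0 →
      ‖(denom M τ ^ (k + l + 2 * m))⁻¹ * F (addPoint (M • τ) ε)‖ ≤ C * (‖denom M τ‖ ^ l)⁻¹ := by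
  obtain ⟨C, hC0, hC⟩ := hF
  have hρ := EisensteinSeries.r_pos τ
  set ρ := EisensteinSeries.r τ
  refine ⟨C * (τ.im ^ r * ρ ^ k)⁻¹ * (ρ ^ (2 * (m - r)))⁻¹, fun M ε hε ↦ ?_⟩
  have hj := norm_denom_pos M τ
  have hτ := τ.im_pos
  have hjρ : ρ ≤ ‖denom M τ‖ :=
    (le_mul_of_one_le_right hρ.le (one_le_norm_of_ne_zero (row_ne_zero M))).trans
      (r_mul_norm_row_le M τ)
  have h1 := hC (addPoint (M • τ) ε) (ρ / ‖denom M τ‖) (by positivity)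
    fun v hv ↦ le_norm_lattice_addPoint M τ ε hε hv
  have him : τ.im / ‖denom M τ‖ ^ 2 ≤ (addPoint (M • τ) ε).im := by
    rw [← Complex.normSq_eq_norm_sq, ← ModularGroup.im_smul_eq_div_normSq]
    change (M • τ).im ≤ ((M • τ : ℍ) + (ε : ℂ)).im
    rw [Complex.add_im, coe_im, coe_im]
    linarith [ε.im_pos]
  rw [norm_mul, norm_inv, norm_pow]
  calc _ ≤ (‖denom M τ‖ ^ (k + l + 2 * m))⁻¹ *
        (C * ((τ.im / ‖denom M τ‖ ^ 2) ^ r * (ρ / ‖denom M τ‖) ^ k)⁻¹) := by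
        gcongr
        exact h1.trans (by gcongr)
    _ = C * (τ.im ^ r * ρ ^ k)⁻¹ * (‖denom M τ‖ ^ (2 * (m - r)))⁻¹ * (‖denom M τ‖ ^ l)⁻¹ := by
        obtain ⟨s, rfl⟩ := Nat.exists_eq_add_of_le hr
        rw [Nat.add_sub_cancel_left, div_pow, div_pow, ← pow_mul]
        field_simp
        ring
    _ ≤ _ := by gcongr

/-! ### Growth of Fourier coefficients -/

/-- The trivial estimate: `σ_j (n) = ∑_{d ∣ n} (n / d) ^ j ≤ n ^ j ∑ d ^ (-2)`. -/
lemma sigma_isBigO {j : ℕ} (hj : 2 ≤ j) :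
    (fun n ↦ (ArithmeticFunction.sigma j n : ℝ)) =O[Filter.atTop] fun n : ℕ ↦ (n : ℝ) ^ j := by
  have hs : Summable fun d : ℕ ↦ ((d : ℝ) ^ 2)⁻¹ := Real.summable_nat_pow_inv.mpr one_lt_two
  refine Asymptotics.IsBigO.of_bound (∑' d : ℕ, ((d : ℝ) ^ 2)⁻¹) (.of_forall fun n ↦ ?_)
  rw [Real.norm_of_nonneg (by positivity), Real.norm_of_nonneg (by positivity),
    ArithmeticFunction.sigma_apply, ← Nat.sum_div_divisors, mul_comm]
  push_cast
  calc ∑ d ∈ n.divisors, (((n / d : ℕ) : ℝ)) ^ j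
      ≤ ∑ d ∈ n.divisors, (n : ℝ) ^ j * ((d : ℝ) ^ 2)⁻¹ := by
        refine sum_le_sum fun d hd ↦ ?_
        have hd1 : (1 : ℝ) ≤ d := by exact_mod_cast Nat.pos_of_mem_divisors hd
        rw [Nat.cast_div (Nat.dvd_of_mem_divisors hd) (by positivity), div_pow, div_eq_mul_inv]
        gcongr
    _ = (n : ℝ) ^ j * ∑ d ∈ n.divisors, ((d : ℝ) ^ 2)⁻¹ := (mul_sum _ _ _).symm
    _ ≤ _ := by
        gcongr
        exact hs.sum_le_tsum _ fun _ _ ↦ by positivity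

lemma cuspForm_coeff_isBigO {k e : ℕ} (hk : k = 2 * e) (f : CuspForm 𝒮ℒ (k : ℤ)) :
    (fun n ↦ (qExpansion 1 f).coeff n) =O[Filter.atTop] fun n : ℕ ↦ (n : ℝ) ^ e := by
  have h := CuspFormClass.qExpansion_isBigO f
  rw [Subgroup.strictWidthInfty_SL2Z] at h
  refine h.congr_right fun n ↦ ?_
  rw [← Real.rpow_natCast, hk]
  congr 1
  push_cast
  ring

lemma E_coeff_isBigO {k : ℕ} (hk : 3 ≤ k) (hk2 : Even k) :
    (fun n ↦ (qExpansion 1 (ModularForm.E hk)).coeff n) =O[Filter.atTop]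
      fun n : ℕ ↦ (n : ℝ) ^ (k - 1) := by
  have h := (sigma_isBigO (j := k - 1) (by omega)).const_mul_left
    ‖(-(2 * k / bernoulli k) : ℂ)‖
  refine Asymptotics.IsBigO.trans (Asymptotics.IsBigO.of_bound 1 ?_) h
  filter_upwards [Filter.eventually_ne_atTop 0] with n hn
  rw [EisensteinSeries.E_qExpansion_coeff hk hk2, if_neg hn]
  simp

/-- The Fourier coefficients of a modular form of even weight `k` grow at most like `n ^ e` with
`2 e + 4 ≤ k + l`: Hecke's bound gives `e = k / 2` for cusp forms, and the Eisenstein series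
requires `e = k - 1` for other forms of weight `k ≥ 4`. -/
lemma exists_coeff_isBigO {k l : ℕ} (hk : Even k) (f : ModularForm 𝒮ℒ (k : ℤ)) (hl4 : 4 ≤ l)
    (hkl : ¬ ModularForm.IsCuspForm f → k + 2 ≤ l) : ∃ e, 2 * e + 4 ≤ k + l ∧
      (fun n ↦ (qExpansion 1 f).coeff n) =O[Filter.atTop] fun n : ℕ ↦ (n : ℝ) ^ e := by
  obtain ⟨e, he⟩ := hk.two_dvd
  by_cases hf : ModularForm.IsCuspForm f
  · obtain ⟨g, rfl⟩ := hf
    exact ⟨e, by omega, cuspForm_coeff_isBigO he g⟩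
  have hkl' := hkl hf
  rcases lt_or_ge k 3 with h3 | h3
  · obtain rfl | rfl : k = 0 ∨ k = 2 := by omega
    · refine ⟨0, by omega, ?_⟩
      obtain ⟨c, hc⟩ := ModularFormClass.levelOne_weight_zero_const f
      have hq : ∀ τ : ℍ, HasSum (fun n ↦ (if n = 0 then c else 0) * qPow n τ) (f τ) := fun τ ↦ by
        rw [hc]
        simpa [qPow] using hasSum_single (f := fun n ↦ (if n = 0 then c else 0) * qPow n τ) 0
          fun n hn ↦ by simp [hn]
      refine Asymptotics.IsBigO.of_bound ‖c‖ (.of_forall fun n ↦ ?_)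
      rw [qExpansion_coeff_of_qSeries hq]
      split_ifs <;> simp
    · have h0 : f = 0 :=
        rank_zero_iff_forall_zero.mp ModularForm.levelOne_weight_two_rank_zero f
      exact absurd (h0 ▸ Submodule.zero_mem (ModularForm.cuspFormSubmodule 𝒮ℒ 2)) hf
  · refine ⟨k - 1, by omega, ?_⟩
    obtain ⟨g, hg⟩ := ModularForm.sub_smul_isCuspForm f (ModularForm.E h3)
      (EisensteinSeries.E_qExpansion_coeff_zero h3 hk)
    have hfun : (g : ℍ → ℂ) = f - (qExpansion 1 f).coeff 0 • (ModularForm.E h3 : ℍ → ℂ) :=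
      congrArg DFunLike.coe hg
    have hq (n : ℕ) : (qExpansion 1 f).coeff n =
        (qExpansion 1 g).coeff n +
          (qExpansion 1 f).coeff 0 * (qExpansion 1 (ModularForm.E h3)).coeff n := by
      have h := ModularForm.qExpansion_sub one_pos one_mem_strictPeriods_SL f
        ((qExpansion 1 f).coeff 0 • ModularForm.E h3)
      rw [FunLike.coe_smul,
        ModularForm.qExpansion_smul one_pos one_mem_strictPeriods_SL, ← hfun] at h
      rw [h]
      simp
    rw [funext hq]
    refine Asymptotics.IsBigO.add ?_ ((E_coeff_isBigO h3 hk).const_mul_left _)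
    refine (cuspForm_coeff_isBigO he g).trans (Asymptotics.IsBigO.of_bound 1 ?_)
    filter_upwards [Filter.eventually_ge_atTop 1] with n hn
    have hn' : (1 : ℝ) ≤ n := by exact_mod_cast hn
    rw [Real.norm_of_nonneg (by positivity), Real.norm_of_nonneg (by positivity), one_mul]
    exact pow_le_pow_right₀ hn' (by omega)

/-! ### The Fourier expansion of the seed -/

/-- The `n`-th Fourier coefficient of `q ^ (-N)` times the seed of `f = ∑ aₙ qⁿ`. -/
def seedCoeff (k l : ℤ) (m N : ℕ) (a : ℕ → ℂ) (n : ℕ) : ℂ :=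
  ∑ r ∈ range (m + 1), (-1) ^ r * ((Ring.choose (k + m - 1) (m - r) : ℤ) : ℂ) *
    ((Ring.choose (l + m - 1) r : ℤ) : ℂ) * (N : ℂ) ^ (m - r) * ((n : ℂ) ^ r * a n)

lemma hasSum_seedCoeff {a : ℕ → ℂ} {f : ℍ → ℂ} (hf : ∀ τ, HasSum (fun n ↦ a n * qPow n τ) (f τ))
    (k l : ℤ) (m N : ℕ) (τ : ℍ) :
    HasSum (fun n ↦ (if N ≤ n then seedCoeff k l m N a (n - N) else 0) * qPow n τ)
      (seed k l m N f τ) := by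
  have h1 := (hasSum_sum (s := range (m + 1)) fun r _ ↦ (hasSum_iterD_of_qSeries hf r τ).mul_left
    ((-1) ^ r * ((Ring.choose (k + m - 1) (m - r) : ℤ) : ℂ) *
      ((Ring.choose (l + m - 1) r : ℤ) : ℂ) * (N : ℂ) ^ (m - r))).mul_left (qPow N τ)
  have h2 := (hasSum_nat_add_iff (g := seed k l m N f τ)
    (f := fun n ↦ (if N ≤ n then seedCoeff k l m N a (n - N) else 0) * qPow n τ) N).mp <| by
      refine h1.congr_fun fun n ↦ ?_
      simp only [Nat.le_add_left, if_true, Nat.add_sub_cancel, seedCoeff, sum_mul, mul_sum]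
      refine sum_congr rfl fun r _ ↦ ?_
      simp only [qPow, pow_add]
      ring
  have h3 : ∑ n ∈ range N, (if N ≤ n then seedCoeff k l m N a (n - N) else 0) * qPow n τ = 0 :=
    sum_eq_zero fun n hn ↦ by simp [mem_range.mp hn]
  rwa [h3, add_zero] at h2

lemma seedCoeff_isBigO {a : ℕ → ℂ} {e : ℕ}
    (ha : a =O[Filter.atTop] fun n : ℕ ↦ (n : ℝ) ^ e) (k l : ℤ) (m N : ℕ) :
    seedCoeff k l m N a =O[Filter.atTop] fun n : ℕ ↦ (n : ℝ) ^ (m + e) := by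
  refine Asymptotics.IsBigO.fun_sum fun r hr ↦ Asymptotics.IsBigO.const_mul_left ?_ _
  have hr' : r ≤ m := by simpa [Nat.lt_succ_iff] using hr
  simp_rw [pow_add]
  refine Asymptotics.IsBigO.mul (Asymptotics.IsBigO.of_bound 1 ?_) ha
  filter_upwards [Filter.eventually_ge_atTop 1] with n hn
  have hn' : (1 : ℝ) ≤ n := by exact_mod_cast hn
  rw [norm_pow, norm_pow, one_mul, Complex.norm_natCast, Real.norm_natCast]
  exact pow_le_pow_right₀ hn' hr'

/-! ### The sum over the Fourier coefficients of the seed -/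

/-- The hypothesis of `hasSum_mul_poincareSeries_of_dominated` for the seed. -/
lemma exists_bound_seed_addPoint {k : ℕ} {f : ℍ → ℂ} (hf : LatticeBound k 0 f) (hd : MDiff f)
    (l m N : ℕ) (τ : ℍ) : ∃ C, ∀ (M : SL(2, ℤ)) (ε : ℍ), ε.re = 0 →
      ‖(denom M τ ^ (k + l + 2 * m))⁻¹ * seed k l m N f (addPoint (M • τ) ε)‖ ≤
        C * (‖denom M τ‖ ^ l)⁻¹ := by
  choose! C hC using fun r (hr : r ∈ range (m + 1)) ↦
    (hf.iterD hd r).exists_bound_addPoint τ l (m := m)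
      (by simpa [Nat.lt_succ_iff] using hr)
  let b (r : ℕ) : ℂ := (-1) ^ r * ((Ring.choose ((k : ℤ) + m - 1) (m - r) : ℤ) : ℂ) *
    ((Ring.choose ((l : ℤ) + m - 1) r : ℤ) : ℂ) * (N : ℂ) ^ (m - r)
  refine ⟨∑ r ∈ range (m + 1), ‖b r‖ * C r, fun M ε hε ↦ ?_⟩
  have hseed : (denom M τ ^ (k + l + 2 * m))⁻¹ * seed k l m N f (addPoint (M • τ) ε) =
      qPow N (addPoint (M • τ) ε) * ∑ r ∈ range (m + 1), b r *
        ((denom M τ ^ (k + l + 2 * m))⁻¹ * iterD r f (addPoint (M • τ) ε)) := by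
    rw [seed, mul_left_comm, mul_sum]
    congr 1
    exact sum_congr rfl fun r _ ↦ mul_left_comm _ _ _
  rw [hseed, norm_mul, sum_mul]
  refine (mul_le_of_le_one_left (norm_nonneg _) (norm_qPow_le_one _ _)).trans
    ((norm_sum_le _ _).trans (sum_le_sum fun r hr ↦ ?_))
  rw [norm_mul, mul_assoc]
  exact mul_le_mul_of_nonneg_left (hC r hr M ε hε) (norm_nonneg _)

lemma hasSum_seed_mul_poincareSeries {k l m N e : ℕ} (hl : 3 ≤ l) (he : 2 * e + 4 ≤ k + l)
    (hkl : Even (k + l)) {f : ℍ → ℂ} {a : ℕ → ℂ}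
    (hf : ∀ τ, HasSum (fun n ↦ a n * qPow n τ) (f τ)) (hk : ∀ M : SL(2, ℤ), f ∣[(k : ℤ)] M = f)
    (ha : a =O[Filter.atTop] fun n : ℕ ↦ (n : ℝ) ^ e) (τ : ℍ) :
    HasSum (fun n : ℕ ↦ (qExpansion 1 (seed k l m N f)).coeff n *
        poincareSeries (k + l + 2 * m : ℕ) n τ)
      (poincareAverage (k + l + 2 * m : ℕ) (seed k l m N f) τ) := by
  have hd := (mdifferentiable_and_hasSum_normalizedDeriv_of_qSeries hf).1
  have hs := hasSum_seedCoeff hf k l m N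
  simp_rw [qExpansion_coeff_of_qSeries hs]
  obtain ⟨C, hC⟩ := exists_bound_seed_addPoint
    (latticeBound_of_slash_eq hd.continuous (isBoundedAtImInfty_of_qSeries hf) hk) hd l m N τ
  refine hasSum_mul_poincareSeries_of_dominated (by omega) hs τ ?_
    ((summable_norm_denom hl τ).mul_left C) fun x ε hε ↦ hC x.out ε hε
  obtain ⟨u, hu⟩ := hkl.two_dvd
  have hw : k + l + 2 * m = 2 * (u + m) := by omega
  have hP := summable_pow_mul_norm_poincareSeries (v := u + m) (by omega) τ
  rw [← hw] at hP
  rw [← summable_nat_add_iff N] at hP ⊢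
  refine summable_of_isBigO_nat hP ?_
  simp only [Nat.le_add_left, if_true, Nat.add_sub_cancel, norm_mul]
  refine Asymptotics.IsBigO.mul ?_ (Asymptotics.isBigO_refl _ _)
  refine (seedCoeff_isBigO ha k l m N).norm_left.trans (Asymptotics.IsBigO.of_bound 1 ?_)
  filter_upwards [Filter.eventually_ge_atTop 1] with n hn
  have hn' : (1 : ℝ) ≤ n := by exact_mod_cast hn
  rw [Real.norm_of_nonneg (by positivity), Real.norm_of_nonneg (by positivity), one_mul]
  calc (n : ℝ) ^ (m + e) ≤ (n : ℝ) ^ (u + m - 2) := pow_le_pow_right₀ hn' (by omega)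
    _ ≤ _ := by gcongr; exact le_add_right le_rfl

lemma seed_zero (k l : ℤ) (m N : ℕ) : seed k l m N 0 = 0 := by
  have h (r : ℕ) : iterD r (0 : ℍ → ℂ) = 0 := by
    induction r with
    | zero => rfl
    | succ r ih => rw [iterD_succ, ih, normalizedDeriv_zero]
  ext τ
  simp [seed, h]

end RankinCohenPoincare

end

open RankinCohenPoincare in
theorem theorem2 (k : ℤ) (f : ModularForm 𝒮ℒ k) (l : ℕ) (hl : Even l) (hl4 : 4 ≤ l) (m N : ℕ)
    (hkl : ¬ ModularForm.IsCuspForm f → k + 2 ≤ (l : ℤ)) :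
    -- the series over cosets that defines the average of the seed converges absolutely and
    -- locally uniformly
    (∀ τ : ℍ, Summable fun c : Cosets ↦ ‖poincareTerm (k + l + 2 * m) (seed k l m N f) c τ‖) ∧
    HasSumLocallyUniformly (poincareTerm (k + l + 2 * m) (seed k l m N f))
      (poincareAverage (k + l + 2 * m) (seed k l m N f)) ∧
    -- its sum is the bracket
    rankinCohen k l m f (poincareSeries l N) =
      poincareAverage (k + l + 2 * m) (seed k l m N f) ∧
    -- so is the sum `∑ aₙ P_{k+l+2m,n}` over the Fourier coefficients `aₙ` of the seed
    ∀ τ : ℍ, HasSum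
      (fun n : ℕ ↦ (qExpansion 1 (seed k l m N f)).coeff n * poincareSeries (k + l + 2 * m) n τ)
      (rankinCohen k l m f (poincareSeries l N) τ) := by
  have hd : MDiff (f : ℍ → ℂ) := f.holo'
  have hslash (M : SL(2, ℤ)) : (f : ℍ → ℂ) ∣[k] M = f := f.slash_action_eq' _ ⟨M, rfl⟩
  have hl3 : 3 ≤ l := by omega
  have hdom := locallyDominated_poincareTerm_seed hd hslash hl3 m N
  have hRC := rankinCohen_poincareSeries hd hslash hl3 m N
  refine ⟨hdom.summable_norm, hdom.hasSumLocallyUniformly, hRC, fun τ ↦ ?_⟩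
  rw [hRC]
  by_cases hf0 : (f : ℍ → ℂ) = 0
  -- the case `f = 0` disposes of all negative and odd weights
  · simp only [hf0, seed_zero, qExpansion_zero, map_zero, zero_mul, poincareAverage,
      poincareTerm, SlashAction.zero_slash, Pi.zero_apply, tsum_zero]
    exact hasSum_zero
  have hk0 : 0 ≤ k := by
    by_contra! h
    exact hf0 (ModularFormClass.levelOne_neg_weight_eq_zero h f)
  have hk : Even k := by
    by_contra h
    exact hf0 (by rw [ModularForm.levelOne_odd_weight_eq_zero (Int.not_even_iff_odd.mp h) f]; rfl)
  lift k to ℕ using hk0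
  obtain ⟨e, he, ha⟩ := exists_coeff_isBigO (by exact_mod_cast hk) f hl4
    fun h ↦ by exact_mod_cast hkl h
  have hq (z : ℍ) : HasSum (fun n ↦ (qExpansion 1 f).coeff n * qPow n z) (f z) := by
    simpa only [qPow_eq_qParam] using
      ModularForm.hasSum_qExpansion f one_pos one_mem_strictPeriods_SL z
  have h := hasSum_seed_mul_poincareSeries (m := m) (N := N) hl3 he
    (by exact_mod_cast hk.add ((Int.even_coe_nat l).mpr hl)) hq hslash ha τ
  exact_mod_cast h
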